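/- Let $\Gamma\subset\mathbb{R}^2$ be a regular simple closed curve of class $C^2$ (for instance a smooth one), and let $\Omega$ be its interior, i.e. the set of points of $\mathbb{R}^2\setminus\Gamma$ whose connected component in $\mathbb{R}^2\setminus\Gamma$ is bounded. Let $\mathbf n$ be the unit normal on $\partial\Omega=\Gamma$ pointing out of $\Omega$, let $ds$ be arc length on $\partial\Omega$, and let $$\Phi(z)=\frac1{2\pi}\log\frac1{|z|},\qquad z\in\mathbb{R}^2\setminus\{0\},$$ be the fundamental solution of Laplace's equation in the plane. Let $h$ be a bounded function on $\Omega$ and let $u\in C^2(\Omega)\cap C^1(\overline\Omega)$ be a solution of Poisson's equation $\Delta u=h$ in $\Omega$. Then for every $x\in\partial\Omega$ the two integrals below converge absolutely and $$\int_\Omega \Phi(x-y)\,\Delta u(y)\,dy=\int_{\partial\Omega}\left(\Phi(x-y)\,\frac{\partial u}{\partial \mathbf n}(y)-u(y)\,\frac{\partial}{\partial \mathbf n_y}\Phi(x-y)\right)ds(y)-\frac12\,u(x),$$ where $\frac{\partial}{\partial \mathbf n_y}\Phi(x-y)$ is the derivative of $y\mapsto\Phi(x-y)$ in the direction $\mathbf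 n$ at $y$. -/

import Mathlib

open MeasureTheory Set Filter Topology

noncomputable section

namespace PlanarPotential

/-- The Euclidean plane. -/
abbrev Plane : Type := EuclideanSpace ℝ (Fin 2)

/-- `γ`, of period `1`, parametrizes a regular simple closed plane curve of class `C²`. -/
structure IsRegularSimpleClosedCurve (γ : ℝ → Plane) : Prop where
  contDiff : ContDiff ℝ 2 γ
  periodic : Function.Periodic γ 1
  regular : ∀ t, deriv γ t ≠ 0
  simple : InjOn γ (Ico 0 1)

/-- The interior of a closed curve: the points off the curve whose connected component in the
complement of the curve is bounded. -/
def curveInterior (γ : ℝ → Plane) : Set Plane :=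
  {p | p ∈ (range γ)ᶜ ∧ Bornology.IsBounded (connectedComponentIn (range γ)ᶜ p)}

/-- The unit tangent of `γ` at parameter `t`, rotated by `-π/2`. -/
def rotatedTangent (γ : ℝ → Plane) (t : ℝ) : Plane :=
  ‖deriv γ t‖⁻¹ • !₂[deriv γ t 1, -(deriv γ t 0)]

open Classical in
/-- The unit normal of `γ` at parameter `t` that points out of the interior of `γ`. -/
def outwardNormal (γ : ℝ → Plane) (t : ℝ) : Plane :=
  if ∀ᶠ s in 𝓝[>] (0 : ℝ), γ t + s • rotatedTangent γ t ∉ curveInterior γ then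
    rotatedTangent γ t
  else
    -rotatedTangent γ t

/-- The fundamental solution of Laplace's equation in the plane. -/
def fundamentalSolution (z : Plane) : ℝ :=
  1 / (2 * Real.pi) * Real.log (1 / ‖z‖)

/-- `u` is a classical solution of Poisson's equation `Δ u = h` in `Ω`, of class `C²` in `Ω` and
of class `C¹` up to the boundary. -/
structure IsPoissonSolution (Ω : Set Plane) (h u : Plane → ℝ) : Prop where
  contDiffOn_interior : ContDiffOn ℝ 2 u Ω
  contDiffOn_closure : ContDiffOn ℝ 1 u (closure Ω)
  equation : ∀ y ∈ Ω, Laplacian.laplacian u y = h y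

/-- The derivative `∂u/∂n` along the outward unit normal at the boundary point `γ t` of the
interior of `γ`, for a function `u` on the closure of that interior. -/
def normalDeriv (γ : ℝ → Plane) (u : Plane → ℝ) (t : ℝ) : ℝ :=
  fderivWithin ℝ u (closure (curveInterior γ)) (γ t) (outwardNormal γ t)

/-- The derivative of `y ↦ Φ (x - y)` along the outward unit normal at `y = γ t`, where `Φ` is the
fundamental solution. -/
def normalDerivKernel (γ : ℝ → Plane) (x : Plane) (t : ℝ) : ℝ :=
  fderiv ℝ (fun y => fundamentalSolution (x - y)) (γ t) (outwardNormal γ t)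

end PlanarPotential

end

/-!
Put `y ↦ Φ (x - y)` in place of `φ` in Green's second identity
`∫_Ω (φ Δu - u Δφ) = ∫_∂Ω (φ ∂u/∂n - u ∂φ/∂n) ds`. The singularity at the boundary point `x` is
handled by the smooth regularization `φ_r y = -(1/4π) log (|y - x|² + r²)`, for which the identity
holds on all of `Ω`. Its Laplacian `-(1/π) r² / (|y - x|² + r²)²` is an approximate point mass `-1`
at `x`. Since `x` lies on a `C¹` boundary, `Ω` looks like a half plane at the scale `r`, so that only
half of this mass lies in `Ω`, and `∫_Ω u Δφ_r → -u(x)/2`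
(`IsInnerTube.tendsto_integral_mul_laplacian_regKernel`). The remaining terms converge by domination:
`φ_r` is bounded by the logarithm of the distance to `x`, and `∂φ_r/∂n` is bounded along the curve
because a curve of class `C²` leaves its tangent only to second order
(`IsRegularSimpleClosedCurve.exists_abs_inner_normalField_le`).

Green's identity follows from the divergence theorem `IsInnerTube.integral_divergence_eq` for covector
fields `L` that are `C¹` in `Ω` and merely continuous up to the boundary. The tube map
`(t, s) ↦ γ t - s n(t)` gives `C¹` coordinates near the curve. For a cutoff function `ψ` depending on
`s / ε` only, `∫ ψ div L = -∫ dψ · L`, and in the tube coordinates the right-hand side is an average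
of fluxes of `L` through parallel curves at distance of order `ε`, which tends to the flux through
the curve.

No Jordan curve theorem is needed. Each component of the complement of the curve has a frontier point
on the curve, hence contains one of the two sides of the tube. When `Ω` is nonempty, one side lies in
a bounded component and the other one must lie in the unbounded component
(`IsRegularSimpleClosedCurve.exists_isInnerTube`), which locates `Ω` near its boundary and identifies
the outward normal.
-/

noncomputable section

namespace PlanarPotential

/-! ### Rotation and the cross product -/

/-- The rotation of the plane by `-π/2`. -/
def rot : Plane →L[ℝ] Plane :=
  LinearMap.toContinuousLinearMap
    { toFun := fun v => !₂[v 1, -(v 0)]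
      map_add' := fun v w => by ext i; fin_cases i <;> simp [add_comm]
      map_smul' := fun c v => by ext i; fin_cases i <;> simp }

@[simp] theorem rot_apply_zero (v : Plane) : rot v 0 = v 1 := rfl

@[simp] theorem rot_apply_one (v : Plane) : rot v 1 = -(v 0) := rfl

/-- The determinant of two plane vectors. -/
def cross (a b : Plane) : ℝ := a 0 * b 1 - a 1 * b 0

theorem inner_eq_coords (v w : Plane) : inner ℝ v w = v 0 * w 0 + v 1 * w 1 := by
  simp [PiLp.inner_apply, Fin.sum_univ_two, mul_comm]

theorem norm_sq_eq_coords (v : Plane) : ‖v‖ ^ 2 = v 0 ^ 2 + v 1 ^ 2 := by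
  rw [EuclideanSpace.norm_sq_eq]; simp [Fin.sum_univ_two]

theorem norm_rot (v : Plane) : ‖rot v‖ = ‖v‖ := by
  rw [← sq_eq_sq₀ (norm_nonneg _) (norm_nonneg _), norm_sq_eq_coords, norm_sq_eq_coords]
  simp; ring

/-- The linear map of the plane whose columns are `a` and `b`. -/
def ofColumns (a b : Plane) : Plane →L[ℝ] Plane :=
  (EuclideanSpace.proj (0 : Fin 2) : Plane →L[ℝ] ℝ).smulRight a +
    (EuclideanSpace.proj (1 : Fin 2) : Plane →L[ℝ] ℝ).smulRight b

@[simp] theorem ofColumns_apply (a b v : Plane) : ofColumns a b v = v 0 • a + v 1 • b := by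
  simp [ofColumns]

theorem det_ofColumns (a b : Plane) : (ofColumns a b).det = cross a b := by
  have h : LinearMap.toMatrix (EuclideanSpace.basisFun (Fin 2) ℝ).toBasis
      (EuclideanSpace.basisFun (Fin 2) ℝ).toBasis (ofColumns a b : Plane →ₗ[ℝ] Plane)
      = !![a 0, b 0; a 1, b 1] := by
    ext i j
    fin_cases i <;> fin_cases j <;> simp [LinearMap.toMatrix_apply]
  rw [ContinuousLinearMap.det, ← LinearMap.det_toMatrix (EuclideanSpace.basisFun (Fin 2) ℝ).toBasis,
    h, Matrix.det_fin_two]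
  simp [cross]; ring

/-! ### The tube around a curve -/

/-- The normal field `σ • rot γ'` along the curve `γ`, of the same length as `γ'`. The sign `σ = ±1`
chooses the side. -/
def normalField (σ : ℝ) (γ : ℝ → Plane) (t : ℝ) : Plane := σ • rot (deriv γ t)

/-- The tube map `(t, s) ↦ γ t - s n(t)`, where `n` is the normal field of sign `σ`. -/
def tubeMap (σ : ℝ) (γ : ℝ → Plane) (p : Plane) : Plane := γ (p 0) - p 1 • normalField σ γ (p 0)

/-- The partial derivative of the tube map along the curve. -/
def tubeTangent (σ : ℝ) (γ : ℝ → Plane) (p : Plane) : Plane :=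
  deriv γ (p 0) - p 1 • deriv (normalField σ γ) (p 0)

/-- The derivative of the tube map. -/
def tubeDeriv (σ : ℝ) (γ : ℝ → Plane) (p : Plane) : Plane →L[ℝ] Plane :=
  ofColumns (tubeTangent σ γ p) (-normalField σ γ (p 0))

theorem continuous_coord (i : Fin 2) : Continuous fun p : Plane => p i :=
  (EuclideanSpace.proj i : Plane →L[ℝ] ℝ).continuous

theorem hasStrictFDerivAt_coord (i : Fin 2) (p : Plane) :
    HasStrictFDerivAt (fun p : Plane => p i) (EuclideanSpace.proj i : Plane →L[ℝ] ℝ) p :=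
  (EuclideanSpace.proj i : Plane →L[ℝ] ℝ).hasStrictFDerivAt

theorem contDiff_coord (i : Fin 2) {n : WithTop ℕ∞} : ContDiff ℝ n fun p : Plane => p i :=
  (EuclideanSpace.proj i : Plane →L[ℝ] ℝ).contDiff

/-- A continuous `1`-periodic function is bounded. -/
theorem exists_norm_le_of_periodic {E : Type*} [NormedAddCommGroup E] {f : ℝ → E}
    (hf : Continuous f) (hp : Function.Periodic f 1) : ∃ M, 0 ≤ M ∧ ∀ t, ‖f t‖ ≤ M := by
  obtain ⟨M, hM⟩ := (isCompact_Icc (a := (0 : ℝ)) (b := 1)).exists_bound_of_continuousOn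
    hf.continuousOn
  refine ⟨M, (norm_nonneg _).trans (hM 0 (by simp)), fun t => ?_⟩
  obtain ⟨y, hy, hyt⟩ := hp.exists_mem_Ico₀ one_pos t
  rw [hyt]
  exact hM y ⟨hy.1, hy.2.le⟩

/-- The derivative of a periodic function is periodic. -/
theorem periodic_deriv {E : Type*} [NormedAddCommGroup E] [NormedSpace ℝ E] {f : ℝ → E} {c : ℝ}
    (hp : Function.Periodic f c) : Function.Periodic (deriv f) c := by
  intro t
  have h : (fun s => f (s + c)) = f := funext hp
  rw [← deriv_comp_add_const, h]

namespace IsRegularSimpleClosedCurve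

variable {γ : ℝ → Plane} {σ : ℝ}

theorem continuous (hγ : IsRegularSimpleClosedCurve γ) : Continuous γ := hγ.contDiff.continuous

theorem hasDerivAt (hγ : IsRegularSimpleClosedCurve γ) (t : ℝ) : HasDerivAt γ (deriv γ t) t :=
  (hγ.contDiff.differentiable (by norm_num) t).hasDerivAt

theorem contDiff_deriv (hγ : IsRegularSimpleClosedCurve γ) : ContDiff ℝ 1 (deriv γ) :=
  ((contDiff_succ_iff_deriv (n := 1)).1 (by rw [one_add_one_eq_two]; exact hγ.contDiff)).2.2

theorem continuous_deriv (hγ : IsRegularSimpleClosedCurve γ) : Continuous (deriv γ) :=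
  hγ.contDiff_deriv.continuous

theorem contDiff_normalField (hγ : IsRegularSimpleClosedCurve γ) :
    ContDiff ℝ 1 (normalField σ γ) :=
  (rot.contDiff.comp hγ.contDiff_deriv).const_smul σ

theorem continuous_normalField (hγ : IsRegularSimpleClosedCurve γ) :
    Continuous (normalField σ γ) :=
  hγ.contDiff_normalField.continuous

theorem periodic_normalField (hγ : IsRegularSimpleClosedCurve γ) :
    Function.Periodic (normalField σ γ) 1 := fun t => by
  simp [normalField, periodic_deriv hγ.periodic t]

theorem contDiff_tubeMap (hγ : IsRegularSimpleClosedCurve γ) : ContDiff ℝ 1 (tubeMap σ γ) :=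
  ((hγ.contDiff.of_le (by norm_num)).comp (contDiff_coord 0)).sub
    ((contDiff_coord 1).smul (hγ.contDiff_normalField.comp (contDiff_coord 0)))

theorem continuous_tubeMap (hγ : IsRegularSimpleClosedCurve γ) : Continuous (tubeMap σ γ) :=
  hγ.contDiff_tubeMap.continuous

theorem continuous_tubeTangent (hγ : IsRegularSimpleClosedCurve γ) :
    Continuous (tubeTangent σ γ) := by
  have h1 := hγ.continuous_deriv
  have h2 : Continuous (deriv (normalField σ γ)) :=
    (hγ.contDiff_normalField (σ := σ)).continuous_deriv le_rfl
  exact (h1.comp (continuous_coord 0)).sub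
    ((continuous_coord 1).smul (h2.comp (continuous_coord 0)))

theorem hasFDerivAt_tubeMap (hγ : IsRegularSimpleClosedCurve γ) (p : Plane) :
    HasFDerivAt (tubeMap σ γ) (tubeDeriv σ γ p) p := by
  have c0 := (hasStrictFDerivAt_coord 0 p).hasFDerivAt
  have c1 := (hasStrictFDerivAt_coord 1 p).hasFDerivAt
  have hn : HasDerivAt (normalField σ γ) (deriv (normalField σ γ) (p 0)) (p 0) :=
    (hγ.contDiff_normalField.differentiable (by norm_num) _).hasDerivAt
  have h1 := (hγ.hasDerivAt (p 0)).hasFDerivAt.comp p c0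
  have h2 := c1.smul (hn.hasFDerivAt.comp p c0)
  refine (h1.sub h2).congr_fderiv ?_
  ext v i
  simp [tubeDeriv, tubeTangent]
  ring

theorem hasStrictFDerivAt_tubeMap (hγ : IsRegularSimpleClosedCurve γ) (p : Plane) :
    HasStrictFDerivAt (tubeMap σ γ) (tubeDeriv σ γ p) p :=
  (hγ.contDiff_tubeMap.contDiffAt).hasStrictFDerivAt' (hγ.hasFDerivAt_tubeMap p) (by norm_num)

theorem tubeMap_eq_of_coe_eq (hγ : IsRegularSimpleClosedCurve γ) {p q : Plane} (k : ℤ)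
    (h0 : p 0 = q 0 + k) (h1 : p 1 = q 1) : tubeMap σ γ p = tubeMap σ γ q := by
  have e1 := (hγ.periodic.int_mul k) (q 0)
  have e2 := ((hγ.periodic_normalField (σ := σ)).int_mul k) (q 0)
  rw [mul_one] at e1 e2
  simp only [tubeMap, h0, h1, e1, e2]

/-- Two parameters of the same curve point differ by an integer. -/
theorem exists_int_of_eq (hγ : IsRegularSimpleClosedCurve γ) {s t : ℝ} (h : γ s = γ t) :
    ∃ k : ℤ, s = t + k := by
  have hs : γ (Int.fract s) = γ s := by simpa using hγ.periodic.sub_int_mul_eq (x := s) ⌊s⌋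
  have ht : γ (Int.fract t) = γ t := by simpa using hγ.periodic.sub_int_mul_eq (x := t) ⌊t⌋
  have hfr := hγ.simple ⟨Int.fract_nonneg s, Int.fract_lt_one s⟩
    ⟨Int.fract_nonneg t, Int.fract_lt_one t⟩ (hs.trans (h.trans ht.symm))
  refine ⟨⌊s⌋ - ⌊t⌋, ?_⟩
  have a := Int.floor_add_fract s
  have b := Int.floor_add_fract t
  push_cast
  linarith

/-- The Jacobian determinant of the tube map has the sign `σ` near the curve. -/
theorem exists_pos_forall_cross_pos (hγ : IsRegularSimpleClosedCurve γ) (hσ : σ ^ 2 = 1) :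
    ∃ δ > 0, ∀ p : Plane, |p 1| < δ →
      0 < σ * cross (tubeTangent σ γ p) (-normalField σ γ (p 0)) := by
  obtain ⟨m, hm, hmle⟩ : ∃ m > 0, ∀ t, m ≤ ‖deriv γ t‖ ^ 2 := by
    obtain ⟨t, -, ht⟩ := (isCompact_Icc (a := (0 : ℝ)) (b := 1)).exists_isMinOn ⟨0, by simp⟩
      (f := fun t => ‖deriv γ t‖ ^ 2) (hγ.continuous_deriv.norm.pow 2).continuousOn
    refine ⟨‖deriv γ t‖ ^ 2, by have := norm_pos_iff.2 (hγ.regular t); positivity, fun s => ?_⟩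
    obtain ⟨y, hy, hys⟩ := (periodic_deriv hγ.periodic).exists_mem_Ico₀ one_pos s
    rw [hys]
    exact ht (Ico_subset_Icc_self hy)
  have hc : Continuous (deriv (normalField σ γ)) :=
    (hγ.contDiff_normalField (σ := σ)).continuous_deriv le_rfl
  have hper := periodic_deriv (hγ.periodic_normalField (σ := σ))
  let g : ℝ → ℝ := fun t => σ * cross (deriv (normalField σ γ) t) (normalField σ γ t)
  have hg : Continuous g := by
    have := hγ.continuous_normalField (σ := σ)
    have e (i : Fin 2) := (continuous_coord i).comp hc
    have e' (i : Fin 2) := (continuous_coord i).comp this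
    exact continuous_const.mul (((e 0).mul (e' 1)).sub ((e 1).mul (e' 0)))
  obtain ⟨M, hM0, hM⟩ := exists_norm_le_of_periodic hg (fun t => by
    simp only [g, hper t, hγ.periodic_normalField (σ := σ) t])
  refine ⟨m / (M + 1), by positivity, fun p hp => ?_⟩
  have key : σ * cross (tubeTangent σ γ p) (-normalField σ γ (p 0))
      = ‖deriv γ (p 0)‖ ^ 2 + p 1 * g (p 0) := by
    rw [norm_sq_eq_coords]
    simp only [cross, tubeTangent, normalField, g, PiLp.sub_apply, PiLp.neg_apply, PiLp.smul_apply,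
      rot_apply_zero, rot_apply_one, smul_eq_mul]
    linear_combination (deriv γ (p 0) 0 ^ 2 + deriv γ (p 0) 1 ^ 2) * hσ
  rw [key]
  have h1 : |p 1 * g (p 0)| < m := by
    rw [abs_mul]
    calc |p 1| * |g (p 0)| ≤ |p 1| * (M + 1) := by
          have := hM (p 0)
          rw [Real.norm_eq_abs] at this
          gcongr; linarith
      _ < m := by rwa [lt_div_iff₀ (by positivity)] at hp
  have := (abs_lt.1 h1).1
  linarith [hmle (p 0)]

/-- The derivative of the tube map is invertible where its determinant does not vanish. -/
theorem exists_equiv_tubeDeriv {p : Plane}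
    (h : 0 < σ * cross (tubeTangent σ γ p) (-normalField σ γ (p 0))) :
    ∃ A : Plane ≃L[ℝ] Plane, (A : Plane →L[ℝ] Plane) = tubeDeriv σ γ p := by
  have hd : (tubeDeriv σ γ p).det ≠ 0 := by
    rw [tubeDeriv, det_ofColumns]
    intro h0
    simp [h0] at h
  exact ⟨(tubeDeriv σ γ p).toContinuousLinearEquivOfDetNeZero hd, by ext; simp⟩

/-- The tube map is injective, up to periodicity in the first coordinate, near the curve: on the
compact circle of parameters it is injective and a local diffeomorphism. -/
theorem exists_pos_tubeMap_injective (hγ : IsRegularSimpleClosedCurve γ) (hσ : σ ^ 2 = 1) :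
    ∃ δ > 0, ∀ p q : Plane, |p 1| < δ → |q 1| < δ → tubeMap σ γ p = tubeMap σ γ q →
      (∃ k : ℤ, p 0 = q 0 + k) ∧ p 1 = q 1 := by
  obtain ⟨δ₀, hδ₀, hdet⟩ := hγ.exists_pos_forall_cross_pos hσ
  let π : Plane → AddCircle (1 : ℝ) × ℝ := fun p => (p 0, p 1)
  let f : AddCircle (1 : ℝ) × ℝ → Plane := fun z =>
    hγ.periodic.lift z.1 - z.2 • (hγ.periodic_normalField (σ := σ)).lift z.1
  have hf : Continuous f :=
    ((hγ.continuous.quotient_lift _).comp continuous_fst).sub (continuous_snd.smul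
      ((hγ.continuous_normalField.quotient_lift _).comp continuous_fst))
  have hfπ (p : Plane) : f (π p) = tubeMap σ γ p := rfl
  have hπ : IsOpenMap π := by
    have e : π = Prod.map ((↑) : ℝ → AddCircle (1 : ℝ)) id ∘ fun p : Plane => (p 0, p 1) := rfl
    rw [e]
    refine (QuotientAddGroup.isOpenMap_coe.prodMap IsOpenMap.id).comp ?_
    have := ((EuclideanSpace.equiv (Fin 2) ℝ).toHomeomorph.trans
      (Homeomorph.finTwoArrow (X := ℝ))).isOpenMap
    exact this
  have hK : IsCompact ((univ : Set (AddCircle (1 : ℝ))) ×ˢ ({0} : Set ℝ)) :=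
    isCompact_univ.prod isCompact_singleton
  have hinj : InjOn f ((univ : Set (AddCircle (1 : ℝ))) ×ˢ ({0} : Set ℝ)) := by
    rintro ⟨a, s⟩ ⟨-, rfl⟩ ⟨b, r⟩ ⟨-, rfl⟩ h
    induction a using QuotientAddGroup.induction_on with | H a => ?_
    induction b using QuotientAddGroup.induction_on with | H b => ?_
    have h' : γ a = γ b := by simpa [f] using h
    obtain ⟨k, rfl⟩ := hγ.exists_int_of_eq h'
    simp
  have hloc : ∀ z ∈ (univ : Set (AddCircle (1 : ℝ))) ×ˢ ({0} : Set ℝ), ∃ u ∈ 𝓝 z, InjOn f u := by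
    rintro ⟨a, s⟩ ⟨-, rfl⟩
    induction a using QuotientAddGroup.induction_on with | H a => ?_
    let p : Plane := !₂[a, 0]
    obtain ⟨A, hA⟩ := exists_equiv_tubeDeriv (hdet p (by simpa [p] using hδ₀))
    have hst : HasStrictFDerivAt (tubeMap σ γ) (A : Plane →L[ℝ] Plane) p := by
      rw [hA]; exact hγ.hasStrictFDerivAt_tubeMap p
    let e := hst.toOpenPartialHomeomorph (tubeMap σ γ)
    refine ⟨π '' e.source, ?_, ?_⟩
    · exact hπ.image_mem_nhds (x := p)
        (e.open_source.mem_nhds hst.mem_toOpenPartialHomeomorph_source)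
    · rintro _ ⟨x, hx, rfl⟩ _ ⟨y, hy, rfl⟩ h
      rw [hfπ, hfπ] at h
      rw [e.injOn hx hy h]
  obtain ⟨t, ht, htinj⟩ := hinj.exists_mem_nhdsSet hK (fun z _ => hf.continuousAt) hloc
  obtain ⟨U, V, -, hV, hU', hV', hUV⟩ := generalized_tube_lemma isCompact_univ
    (isCompact_singleton (x := (0 : ℝ))) isOpen_interior (subset_interior_iff_mem_nhdsSet.2 ht)
  obtain ⟨δ, hδ, hδV⟩ := Metric.isOpen_iff.1 hV 0 (hV' rfl)
  refine ⟨δ, hδ, fun p q hp hq h => ?_⟩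
  have mem (p : Plane) (hp : |p 1| < δ) : π p ∈ t :=
    interior_subset (hUV ⟨hU' trivial, hδV (by simpa using hp)⟩)
  have := htinj (mem p hp) (mem q hq) h
  obtain ⟨h0, h1⟩ := Prod.ext_iff.1 this
  refine ⟨?_, h1⟩
  have h0' : ((p 0 - q 0 : ℝ) : AddCircle (1 : ℝ)) = 0 := by
    rw [AddCircle.coe_sub, sub_eq_zero]; exact h0
  obtain ⟨k, hk⟩ := (AddCircle.coe_eq_zero_iff (1 : ℝ)).1 h0'
  exact ⟨k, by simp at hk; linarith⟩

end IsRegularSimpleClosedCurve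

/-! ### The interior of a curve and its sides -/

/-- The exterior of a disc in the plane is connected. -/
theorem isPreconnected_compl_closedBall {R : ℝ} (hR : 0 ≤ R) :
    IsPreconnected (Metric.closedBall (0 : Plane) R)ᶜ := by
  have hs : IsPreconnected (Metric.sphere (0 : Plane) 1) :=
    isPreconnected_sphere (by
      rw [← Module.finrank_eq_rank, finrank_euclideanSpace_fin]; norm_num) 0 1
  have him : (Metric.closedBall (0 : Plane) R)ᶜ =
      (fun z : ℝ × Plane => z.1 • z.2) '' (Ioi R ×ˢ Metric.sphere (0 : Plane) 1) := by
    ext y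
    constructor
    · intro hy
      have hy' : R < ‖y‖ := by simpa using hy
      have hy0 : ‖y‖ ≠ 0 := (hR.trans_lt hy').ne'
      refine ⟨(‖y‖, ‖y‖⁻¹ • y), ⟨hy', ?_⟩, ?_⟩
      · simp [norm_smul, hy0]
      · simp [smul_smul, hy0]
    · rintro ⟨⟨r, v⟩, ⟨hr, hv⟩, rfl⟩
      have hr' : R < r := hr
      have hv' : ‖v‖ = 1 := by simpa using hv
      simpa [norm_smul, hv', abs_of_pos (hR.trans_lt hr')] using hr'
  rw [him]
  exact (isPreconnected_Ioi.prod hs).image _ (by fun_prop)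

theorem not_isBounded_compl_closedBall (R : ℝ) :
    ¬ Bornology.IsBounded (Metric.closedBall (0 : Plane) R)ᶜ := by
  intro h
  have := h.union (Metric.isBounded_closedBall (x := (0 : Plane)) (r := R))
  rw [compl_union_self] at this
  exact NormedSpace.unbounded_univ ℝ Plane this

theorem mem_curveInterior_of_mem_connectedComponentIn {γ : ℝ → Plane} {p q : Plane}
    (hp : p ∈ curveInterior γ) (hq : q ∈ connectedComponentIn (range γ)ᶜ p) :
    q ∈ curveInterior γ :=
  ⟨connectedComponentIn_subset _ _ hq, by rw [← connectedComponentIn_eq hq]; exact hp.2⟩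

namespace IsRegularSimpleClosedCurve

variable {γ : ℝ → Plane} {σ δ : ℝ}

theorem isCompact_range (hγ : IsRegularSimpleClosedCurve γ) : IsCompact (range γ) := by
  have : range γ = γ '' Icc 0 1 := by
    have := hγ.periodic.image_Icc one_pos 0
    simpa using this.symm
  rw [this]
  exact isCompact_Icc.image hγ.continuous

theorem isOpen_compl_range (hγ : IsRegularSimpleClosedCurve γ) : IsOpen (range γ)ᶜ :=
  hγ.isCompact_range.isClosed.isOpen_compl

theorem isOpen_curveInterior (hγ : IsRegularSimpleClosedCurve γ) : IsOpen (curveInterior γ) := by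
  rw [isOpen_iff_mem_nhds]
  intro p hp
  filter_upwards [(hγ.isOpen_compl_range.connectedComponentIn (x := p)).mem_nhds
    (mem_connectedComponentIn hp.1)] with q hq
  exact mem_curveInterior_of_mem_connectedComponentIn hp hq

/-- The points outside a large disc lie in one unbounded component of the complement of the
curve. -/
theorem exists_compl_closedBall_subset (hγ : IsRegularSimpleClosedCurve γ) :
    ∃ R, ∀ z ∉ Metric.closedBall (0 : Plane) R, z ∈ (range γ)ᶜ ∧
      ¬ Bornology.IsBounded (connectedComponentIn (range γ)ᶜ z) := by
  obtain ⟨R, hR⟩ := hγ.isCompact_range.isBounded.subset_closedBall (0 : Plane)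
  have hR' : range γ ⊆ Metric.closedBall (0 : Plane) (max R 0) :=
    hR.trans (Metric.closedBall_subset_closedBall (le_max_left _ _))
  refine ⟨max R 0, fun z hz => ⟨fun h => hz (hR' h), fun hb => ?_⟩⟩
  exact not_isBounded_compl_closedBall (max R 0) (hb.subset
    ((isPreconnected_compl_closedBall (le_max_right _ _)).subset_connectedComponentIn hz
      (compl_subset_compl.2 hR')))

theorem isBounded_curveInterior (hγ : IsRegularSimpleClosedCurve γ) :
    Bornology.IsBounded (curveInterior γ) := by
  obtain ⟨R, hR⟩ := hγ.exists_compl_closedBall_subset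
  refine (Metric.isBounded_closedBall (x := (0 : Plane)) (r := R)).subset fun p hp => ?_
  by_contra h
  exact (hR p h).2 hp.2

theorem closure_curveInterior_subset (hγ : IsRegularSimpleClosedCurve γ) :
    closure (curveInterior γ) ⊆ curveInterior γ ∪ range γ := by
  intro y hy
  by_contra h
  rw [mem_union, not_or] at h
  obtain ⟨q, hq, hqΩ⟩ := mem_closure_iff_nhds.1 hy _
    ((hγ.isOpen_compl_range.connectedComponentIn (x := y)).mem_nhds
      (mem_connectedComponentIn h.2))
  apply h.1
  refine mem_curveInterior_of_mem_connectedComponentIn hqΩ ?_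
  rw [← connectedComponentIn_eq hq]
  exact mem_connectedComponentIn h.2

theorem frontier_curveInterior_subset (hγ : IsRegularSimpleClosedCurve γ) :
    frontier (curveInterior γ) ⊆ range γ := by
  rw [hγ.isOpen_curveInterior.frontier_eq]
  rintro y ⟨hy, hy'⟩
  exact (hγ.closure_curveInterior_subset hy).resolve_left hy'

end IsRegularSimpleClosedCurve

/-- The strip of width `δ` around the curve, on the side chosen by `σ`. -/
def tubeSide (σ : ℝ) (γ : ℝ → Plane) (δ : ℝ) : Set Plane :=
  tubeMap σ γ '' {p | 0 < p 1 ∧ p 1 < δ}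

/-- The tube map of sign `σ` is a local diffeomorphism on the strip of half-width `δ`, injective
up to the period. -/
structure IsTube (σ : ℝ) (γ : ℝ → Plane) (δ : ℝ) : Prop where
  sign : σ ^ 2 = 1
  pos : 0 < δ
  cross_pos : ∀ p : Plane, |p 1| < δ →
    0 < σ * cross (tubeTangent σ γ p) (-normalField σ γ (p 0))
  injective : ∀ p q : Plane, |p 1| < δ → |q 1| < δ → tubeMap σ γ p = tubeMap σ γ q →
    (∃ k : ℤ, p 0 = q 0 + k) ∧ p 1 = q 1

/-- A tube whose positive side lies in the interior of the curve, and whose negative side lies in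
the complement of the interior. -/
structure IsInnerTube (σ : ℝ) (γ : ℝ → Plane) (δ : ℝ) : Prop extends IsTube σ γ δ where
  mem_interior : ∀ p : Plane, 0 < p 1 → p 1 < δ → tubeMap σ γ p ∈ curveInterior γ
  notMem_interior : ∀ p : Plane, -δ < p 1 → p 1 ≤ 0 → tubeMap σ γ p ∉ curveInterior γ

theorem tubeMap_mk (σ : ℝ) (γ : ℝ → Plane) (t s : ℝ) :
    tubeMap σ γ !₂[t, s] = γ t - s • normalField σ γ t := rfl

theorem tubeMap_mk_zero (σ : ℝ) (γ : ℝ → Plane) (t : ℝ) : tubeMap σ γ !₂[t, 0] = γ t := by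
  simp [tubeMap_mk]

theorem tubeMap_eq_of_eq_zero {σ : ℝ} {γ : ℝ → Plane} {p : Plane} (h : p 1 = 0) :
    tubeMap σ γ p = γ (p 0) := by
  simp [tubeMap, h]

theorem tubeMap_neg (σ : ℝ) (γ : ℝ → Plane) (p : Plane) :
    tubeMap (-σ) γ p = tubeMap σ γ !₂[p 0, -p 1] := by
  simp [tubeMap, normalField]

namespace IsTube

variable {γ : ℝ → Plane} {σ δ : ℝ}

theorem mono (h : IsTube σ γ δ) {δ' : ℝ} (h0 : 0 < δ') (hle : δ' ≤ δ) : IsTube σ γ δ' :=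
  ⟨h.sign, h0, fun p hp => h.cross_pos p (hp.trans_le hle),
    fun p q hp hq => h.injective p q (hp.trans_le hle) (hq.trans_le hle)⟩

theorem map_nhds (h : IsTube σ γ δ) (hγ : IsRegularSimpleClosedCurve γ) {p : Plane}
    (hp : |p 1| < δ) : map (tubeMap σ γ) (𝓝 p) = 𝓝 (tubeMap σ γ p) := by
  obtain ⟨A, hA⟩ := IsRegularSimpleClosedCurve.exists_equiv_tubeDeriv (h.cross_pos p hp)
  have hst : HasStrictFDerivAt (tubeMap σ γ) (A : Plane →L[ℝ] Plane) p := by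
    rw [hA]; exact hγ.hasStrictFDerivAt_tubeMap p
  exact hst.map_nhds_eq_of_equiv

theorem notMem_range (h : IsTube σ γ δ) {p : Plane} (hp : |p 1| < δ)
    (h0 : p 1 ≠ 0) : tubeMap σ γ p ∉ range γ := by
  rintro ⟨t, ht⟩
  rw [← tubeMap_mk_zero σ γ t] at ht
  exact h0 (h.injective _ _ (by simpa using h.pos) hp ht).2.symm

theorem isPreconnected_tubeSide (hγ : IsRegularSimpleClosedCurve γ) :
    IsPreconnected (tubeSide σ γ δ) := by
  refine IsPreconnected.image ?_ _ hγ.continuous_tubeMap.continuousOn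
  refine Convex.isPreconnected ?_
  intro p hp q hq a b ha hb hab
  have := (convex_Ioo (0 : ℝ) δ) hp hq ha hb hab
  simpa using this

theorem tubeSide_subset_compl (h : IsTube σ γ δ) : tubeSide σ γ δ ⊆ (range γ)ᶜ := by
  rintro _ ⟨p, hp, rfl⟩
  exact h.notMem_range (by rw [abs_of_pos hp.1]; exact hp.2) hp.1.ne'

theorem tubeSide_subset_of_mem (h : IsTube σ γ δ) (hγ : IsRegularSimpleClosedCurve γ)
    {q y : Plane} (hy : y ∈ tubeSide σ γ δ) (hyq : y ∈ connectedComponentIn (range γ)ᶜ q) :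
    tubeSide σ γ δ ⊆ connectedComponentIn (range γ)ᶜ q := by
  rw [connectedComponentIn_eq hyq]
  exact (isPreconnected_tubeSide hγ).subset_connectedComponentIn hy h.tubeSide_subset_compl

/-- Every component of the complement of the curve contains one of the two sides of the curve:
its frontier is nonempty and lies on the curve. -/
theorem tubeSide_subset_component (h : IsTube σ γ δ) (h' : IsTube (-σ) γ δ)
    (hγ : IsRegularSimpleClosedCurve γ) {q : Plane} (hq : q ∈ (range γ)ᶜ) :
    tubeSide σ γ δ ⊆ connectedComponentIn (range γ)ᶜ q ∨
      tubeSide (-σ) γ δ ⊆ connectedComponentIn (range γ)ᶜ q := by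
  set C := connectedComponentIn (range γ)ᶜ q with hC
  have hCo : IsOpen C := hγ.isOpen_compl_range.connectedComponentIn
  have hqC : q ∈ C := mem_connectedComponentIn hq
  obtain ⟨y, hy⟩ : (frontier C).Nonempty := by
    rw [nonempty_frontier_iff]
    refine ⟨⟨q, hqC⟩, fun hu => ?_⟩
    have : γ 0 ∈ C := hu ▸ mem_univ _
    exact connectedComponentIn_subset _ _ this ⟨0, rfl⟩
  rw [hCo.frontier_eq] at hy
  have hyΓ : y ∈ range γ := by
    by_contra hyΓ
    obtain ⟨z, hz, hzC⟩ := mem_closure_iff_nhds.1 hy.1 _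
      ((hγ.isOpen_compl_range.connectedComponentIn (x := y)).mem_nhds
        (mem_connectedComponentIn hyΓ))
    apply hy.2
    rw [hC, connectedComponentIn_eq hzC, ← connectedComponentIn_eq hz]
    exact mem_connectedComponentIn hyΓ
  obtain ⟨t, rfl⟩ := hyΓ
  have hnhds : tubeMap σ γ '' {p | |p 1| < δ} ∈ 𝓝 (γ t) := by
    rw [← tubeMap_mk_zero σ γ t, ← h.map_nhds hγ (by simpa using h.pos)]
    refine image_mem_map (IsOpen.mem_nhds ?_ (by simpa using h.pos))
    exact isOpen_lt (continuous_coord 1).abs continuous_const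
  obtain ⟨_, ⟨p, hp, rfl⟩, hpC⟩ := mem_closure_iff_nhds.1 hy.1 _ hnhds
  have hp' : |p 1| < δ := hp
  rcases lt_trichotomy (p 1) 0 with h0 | h0 | h0
  · right
    refine h'.tubeSide_subset_of_mem hγ (y := tubeMap σ γ p) ⟨!₂[p 0, -p 1], ?_, ?_⟩ hpC
    · simpa [abs_of_neg h0] using ⟨h0, (abs_of_neg h0) ▸ hp'⟩
    · rw [tubeMap_neg]; simp [tubeMap]
  · rw [tubeMap_eq_of_eq_zero h0] at hpC
    exact absurd ⟨_, rfl⟩ (connectedComponentIn_subset _ _ hpC)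
  · left
    exact h.tubeSide_subset_of_mem hγ ⟨p, ⟨h0, (abs_of_pos h0) ▸ hp'⟩, rfl⟩ hpC

/-- If one side lies in a bounded component and the other one in an unbounded component, the tube
is an inner tube. -/
theorem isInnerTube (h : IsTube σ γ δ) {q z : Plane} (hq : q ∈ curveInterior γ)
    (hz : ¬ Bornology.IsBounded (connectedComponentIn (range γ)ᶜ z))
    (hσ : tubeSide σ γ δ ⊆ connectedComponentIn (range γ)ᶜ q)
    (hσ' : tubeSide (-σ) γ δ ⊆ connectedComponentIn (range γ)ᶜ z) : IsInnerTube σ γ δ := by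
  refine ⟨h, fun p h0 hp => mem_curveInterior_of_mem_connectedComponentIn hq
    (hσ ⟨p, ⟨h0, hp⟩, rfl⟩), fun p hp h0 hmem => ?_⟩
  rcases h0.eq_or_lt with h0 | h0
  · rw [tubeMap_eq_of_eq_zero h0] at hmem
    exact hmem.1 ⟨_, rfl⟩
  · have : tubeMap σ γ p ∈ connectedComponentIn (range γ)ᶜ z := by
      refine hσ' ⟨!₂[p 0, -p 1], ⟨by simpa using h0, by simp; linarith⟩, ?_⟩
      rw [tubeMap_neg]; simp [tubeMap]
    apply hz
    rw [connectedComponentIn_eq this]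
    exact hmem.2

end IsTube

/-- A regular simple closed curve with nonempty interior has its interior locally on exactly one
side: the unbounded component of the complement contains the other side. -/
theorem IsRegularSimpleClosedCurve.exists_isInnerTube {γ : ℝ → Plane}
    (hγ : IsRegularSimpleClosedCurve γ) (hne : (curveInterior γ).Nonempty) :
    ∃ σ δ, IsInnerTube σ γ δ := by
  have ex (σ : ℝ) (hσ : σ ^ 2 = 1) : ∃ δ, IsTube σ γ δ := by
    obtain ⟨a, ha, h1⟩ := hγ.exists_pos_forall_cross_pos hσ
    obtain ⟨b, hb, h2⟩ := hγ.exists_pos_tubeMap_injective hσ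
    exact ⟨min a b, hσ, lt_min ha hb, fun p hp => h1 p (hp.trans_le (min_le_left _ _)),
      fun p q hp hq => h2 p q (hp.trans_le (min_le_right _ _)) (hq.trans_le (min_le_right _ _))⟩
  obtain ⟨a, ha⟩ := ex 1 (by norm_num)
  obtain ⟨b, hb⟩ := ex (-1) (by norm_num)
  have hab : 0 < min a b := lt_min ha.pos hb.pos
  have h₁ := ha.mono hab (min_le_left _ _)
  have h₂ := hb.mono hab (min_le_right _ _)
  obtain ⟨q, hq⟩ := hne
  obtain ⟨R, hR⟩ := hγ.exists_compl_closedBall_subset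
  obtain ⟨z, hz⟩ : ∃ z, z ∉ Metric.closedBall (0 : Plane) R := by
    by_contra! h
    apply not_isBounded_compl_closedBall R
    rw [eq_univ_of_forall h, compl_univ]
    exact Bornology.isBounded_empty
  obtain ⟨hz1, hz2⟩ := hR z hz
  -- A side contained in both components would make them equal, although only one is bounded.
  have key (σ : ℝ) (hq' : tubeSide σ γ (min a b) ⊆ connectedComponentIn (range γ)ᶜ q)
      (hz' : tubeSide σ γ (min a b) ⊆ connectedComponentIn (range γ)ᶜ z) : False := by
    have hy : tubeMap σ γ !₂[0, min a b / 2] ∈ tubeSide σ γ (min a b) :=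
      ⟨_, ⟨half_pos hab, half_lt_self hab⟩, rfl⟩
    apply hz2
    rw [connectedComponentIn_eq (hz' hy), ← connectedComponentIn_eq (hq' hy)]
    exact hq.2
  rcases h₁.tubeSide_subset_component h₂ hγ hq.1 with h | h <;>
    rcases h₁.tubeSide_subset_component h₂ hγ hz1 with h' | h'
  · exact (key _ h h').elim
  · exact ⟨1, _, h₁.isInnerTube hq hz2 h h'⟩
  · exact ⟨-1, _, h₂.isInnerTube hq hz2 h (by rwa [neg_neg])⟩
  · exact (key _ h h').elim

namespace IsInnerTube

variable {γ : ℝ → Plane} {σ δ : ℝ}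

theorem range_subset_closure (h : IsInnerTube σ γ δ) :
    range γ ⊆ closure (curveInterior γ) := by
  rintro _ ⟨t, rfl⟩
  have hc : Continuous fun s : ℝ => γ t - s • normalField σ γ t := by fun_prop
  have ht : Tendsto (fun s : ℝ => γ t - s • normalField σ γ t) (𝓝[>] 0) (𝓝 (γ t)) := by
    have := (hc.tendsto 0).mono_left (nhdsWithin_le_nhds (s := Ioi 0))
    simpa using this
  refine mem_closure_of_tendsto ht ?_
  filter_upwards [Ioo_mem_nhdsGT h.pos] with s hs
  exact h.mem_interior !₂[t, s] hs.1 hs.2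

theorem tubeMap_mem_closure (h : IsInnerTube σ γ δ) {p : Plane} (h0 : 0 ≤ p 1) (hp : p 1 < δ) :
    tubeMap σ γ p ∈ closure (curveInterior γ) := by
  rcases h0.eq_or_lt with h0 | h0
  · rw [tubeMap_eq_of_eq_zero h0.symm]
    exact h.range_subset_closure ⟨_, rfl⟩
  · exact subset_closure (h.mem_interior p h0 hp)

theorem outwardNormal_eq (h : IsInnerTube σ γ δ) (hγ : IsRegularSimpleClosedCurve γ) (t : ℝ) :
    outwardNormal γ t = ‖deriv γ t‖⁻¹ • normalField σ γ t := by
  have hr : rotatedTangent γ t = ‖deriv γ t‖⁻¹ • rot (deriv γ t) := rfl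
  have hpos : 0 < ‖deriv γ t‖⁻¹ := inv_pos.2 (norm_pos_iff.2 (hγ.regular t))
  have ht : Tendsto (fun s : ℝ => s * ‖deriv γ t‖⁻¹) (𝓝[>] 0) (𝓝[>] 0) := by
    refine tendsto_nhdsWithin_iff.2 ⟨?_, ?_⟩
    · have : Continuous fun s : ℝ => s * ‖deriv γ t‖⁻¹ := by fun_prop
      simpa using (this.tendsto 0).mono_left (nhdsWithin_le_nhds (s := Ioi 0))
    · filter_upwards [self_mem_nhdsWithin] with s hs
      exact mul_pos hs hpos
  have hev := ht.eventually (Ioo_mem_nhdsGT h.pos)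
  rcases sq_eq_one_iff.1 h.sign with rfl | rfl
  · rw [outwardNormal, if_pos]
    · simp [hr, normalField]
    · filter_upwards [hev] with s hs
      have := h.notMem_interior !₂[t, -(s * ‖deriv γ t‖⁻¹)] (by simpa using hs.2)
        (by simpa using hs.1.le)
      simpa [tubeMap_mk, hr, normalField, smul_smul] using this
  · rw [outwardNormal, if_neg]
    · simp [hr, normalField]
    · intro hcon
      obtain ⟨s, hs, hs'⟩ := (hev.and hcon).exists
      apply hs'
      have := h.mem_interior !₂[t, s * ‖deriv γ t‖⁻¹] hs.1 hs.2
      simpa [tubeMap_mk, hr, normalField, smul_smul] using this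

theorem uniqueDiffOn_closure (h : IsInnerTube σ γ δ) (hγ : IsRegularSimpleClosedCurve γ) :
    UniqueDiffOn ℝ (closure (curveInterior γ)) := by
  intro y hy
  rcases hγ.closure_curveInterior_subset hy with hy | ⟨t, rfl⟩
  · exact (hγ.isOpen_curveInterior.uniqueDiffWithinAt hy).mono subset_closure
  -- The closed half strip is convex with interior, and the tube map carries it into the closure.
  let S : Set Plane := {p | 0 ≤ p 1 ∧ p 1 < δ}
  have hS : UniqueDiffWithinAt ℝ S (!₂[t, 0] : Plane) := by
    refine uniqueDiffWithinAt_convex ?_ ?_ (subset_closure ?_)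
    · intro p hp q hq a b ha hb hab
      have := (convex_Ico (0 : ℝ) δ) hp hq ha hb hab
      simpa [S] using this
    · have ho : IsOpen {p : Plane | 0 < p 1 ∧ p 1 < δ} :=
        (isOpen_lt continuous_const (continuous_coord 1)).inter
          (isOpen_lt (continuous_coord 1) continuous_const)
      have hsub : {p : Plane | 0 < p 1 ∧ p 1 < δ} ⊆ S := fun p hp => ⟨hp.1.le, hp.2⟩
      refine ⟨!₂[t, δ / 2], interior_maximal hsub ho ?_⟩
      have := h.pos
      exact ⟨by simpa using this, by simpa using this⟩
    · exact ⟨by simp, by simpa using h.pos⟩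
  obtain ⟨A, hA⟩ := IsRegularSimpleClosedCurve.exists_equiv_tubeDeriv
    (h.cross_pos !₂[t, 0] (by simpa using h.pos))
  have hd := (hγ.hasFDerivAt_tubeMap (σ := σ) !₂[t, 0]).hasFDerivWithinAt (s := S)
  have := hd.uniqueDiffWithinAt hS (by rw [← hA]; exact A.surjective.denseRange)
  rw [tubeMap_mk_zero] at this
  refine this.mono ?_
  rintro _ ⟨p, hp, rfl⟩
  exact h.tubeMap_mem_closure hp.1 hp.2

end IsInnerTube

/-! ### The normal coordinate and cutoff functions -/

/-- The standard basis vectors of the plane. -/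
def e (i : Fin 2) : Plane := EuclideanSpace.single i (1 : ℝ)

/-- The open tube of half-width `δ` around the curve. -/
def tube (σ : ℝ) (γ : ℝ → Plane) (δ : ℝ) : Set Plane := tubeMap σ γ '' {p | |p 1| < δ}

/-- The normal coordinate `s` of the point `γ t - s n(t)` of a tube (a junk value off the tube). -/
def tubeCoord (σ : ℝ) (γ : ℝ → Plane) (δ : ℝ) (y : Plane) : ℝ :=
  Function.invFunOn (tubeMap σ γ) {p | |p 1| < δ} y 1

theorem isOpen_strip (δ : ℝ) : IsOpen {p : Plane | |p 1| < δ} :=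
  isOpen_lt (continuous_coord 1).abs continuous_const

namespace IsTube

variable {γ : ℝ → Plane} {σ δ : ℝ}

theorem isOpen_tube (h : IsTube σ γ δ) (hγ : IsRegularSimpleClosedCurve γ) :
    IsOpen (tube σ γ δ) := by
  rw [isOpen_iff_mem_nhds]
  rintro _ ⟨p, hp, rfl⟩
  rw [← h.map_nhds hγ hp]
  exact image_mem_map ((isOpen_strip δ).mem_nhds hp)

theorem tubeCoord_tubeMap (h : IsTube σ γ δ) {p : Plane} (hp : |p 1| < δ) :
    tubeCoord σ γ δ (tubeMap σ γ p) = p 1 := by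
  have hex : ∃ q ∈ {p : Plane | |p 1| < δ}, tubeMap σ γ q = tubeMap σ γ p := ⟨p, hp, rfl⟩
  exact (h.injective _ _ (Function.invFunOn_mem hex) hp (Function.invFunOn_eq hex)).2

theorem contDiffAt_tubeCoord (h : IsTube σ γ δ) (hγ : IsRegularSimpleClosedCurve γ) {p : Plane}
    (hp : |p 1| < δ) : ContDiffAt ℝ 1 (tubeCoord σ γ δ) (tubeMap σ γ p) := by
  obtain ⟨A, hA⟩ := IsRegularSimpleClosedCurve.exists_equiv_tubeDeriv (h.cross_pos p hp)
  have hd : HasFDerivAt (tubeMap σ γ) (A : Plane →L[ℝ] Plane) p := by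
    rw [hA]; exact hγ.hasFDerivAt_tubeMap p
  have hc : ContDiffAt ℝ 1 (tubeMap σ γ) p := hγ.contDiff_tubeMap.contDiffAt
  have hst := hc.hasStrictFDerivAt' hd one_ne_zero
  refine ((contDiff_coord 1).contDiffAt.comp _ (hc.to_localInverse hd one_ne_zero)
    ).congr_of_eventuallyEq ?_
  filter_upwards [hst.eventually_right_inverse,
    hst.localInverse_tendsto.eventually ((isOpen_strip δ).mem_nhds hp)] with y hy hy'
  conv_lhs => rw [← hy]
  exact h.tubeCoord_tubeMap hy'

theorem fderiv_tubeCoord_tubeDeriv (h : IsTube σ γ δ) (hγ : IsRegularSimpleClosedCurve γ)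
    {p : Plane} (hp : |p 1| < δ) (v : Plane) :
    fderiv ℝ (tubeCoord σ γ δ) (tubeMap σ γ p) (tubeDeriv σ γ p v) = v 1 := by
  have h1 := ((h.contDiffAt_tubeCoord hγ hp).differentiableAt one_ne_zero).hasFDerivAt.comp p
    (hγ.hasFDerivAt_tubeMap p)
  have h2 : HasFDerivAt (tubeCoord σ γ δ ∘ tubeMap σ γ) (EuclideanSpace.proj 1 : Plane →L[ℝ] ℝ) p :=
    (hasStrictFDerivAt_coord 1 p).hasFDerivAt.congr_of_eventuallyEq (by
      filter_upwards [(isOpen_strip δ).mem_nhds hp] with q hq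
      exact h.tubeCoord_tubeMap hq)
  exact congrArg (fun B : Plane →L[ℝ] ℝ => B v) (h1.unique h2)

theorem fderiv_tubeCoord_mul_cross (h : IsTube σ γ δ) (hγ : IsRegularSimpleClosedCurve γ)
    {p : Plane} (hp : |p 1| < δ) (w : Plane) :
    fderiv ℝ (tubeCoord σ γ δ) (tubeMap σ γ p) w
      * cross (tubeTangent σ γ p) (-normalField σ γ (p 0)) = cross (tubeTangent σ γ p) w := by
  obtain ⟨A, hA⟩ := IsRegularSimpleClosedCurve.exists_equiv_tubeDeriv (h.cross_pos p hp)
  obtain ⟨v, rfl⟩ : ∃ v, tubeDeriv σ γ p v = w := ⟨A.symm w, by rw [← hA]; simp⟩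
  rw [h.fderiv_tubeCoord_tubeDeriv hγ hp, tubeDeriv, ofColumns_apply]
  simp only [cross, PiLp.add_apply, PiLp.smul_apply, smul_eq_mul]
  ring

end IsTube

/-- The profile of the cutoff functions: a smooth transition from `0` for `s ≤ ε` to `1` for
`2 ε ≤ s`. -/
def cutoffProfile (ε s : ℝ) : ℝ := Real.smoothTransition (s / ε - 1)

/-- The cutoff function of the interior of the curve. In the tube it is a function of the normal
coordinate `s` alone, so that it vanishes up to a distance of order `ε` from the curve. -/
def cutoff (σ : ℝ) (γ : ℝ → Plane) (δ ε : ℝ) (y : Plane) : ℝ := by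
  classical
  exact if y ∈ tube σ γ δ then cutoffProfile ε (tubeCoord σ γ δ y)
    else (curveInterior γ).indicator (fun _ => 1) y

theorem contDiff_cutoffProfile (ε : ℝ) : ContDiff ℝ 1 (cutoffProfile ε) :=
  Real.smoothTransition.contDiff.comp ((contDiff_id.div_const ε).sub contDiff_const)

theorem cutoffProfile_eq_zero {ε s : ℝ} (hε : 0 < ε) (h : s ≤ ε) : cutoffProfile ε s = 0 := by
  apply Real.smoothTransition.zero_of_nonpos
  rw [sub_nonpos, div_le_one hε]
  exact h

theorem cutoffProfile_eq_one {ε s : ℝ} (hε : 0 < ε) (h : 2 * ε ≤ s) : cutoffProfile ε s = 1 := by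
  apply Real.smoothTransition.one_of_one_le
  rw [le_sub_iff_add_le, le_div_iff₀ hε]
  linarith

theorem deriv_cutoffProfile_mul {ε : ℝ} (hε : 0 < ε) (τ : ℝ) :
    ε * deriv (cutoffProfile ε) (ε * τ) = deriv Real.smoothTransition (τ - 1) := by
  have h1 : HasDerivAt (fun s : ℝ => s / ε - 1) (1 / ε) (ε * τ) :=
    ((hasDerivAt_id _).div_const ε).sub_const 1
  have e1 : ε * τ / ε - 1 = τ - 1 := by field_simp
  have h2 : HasDerivAt Real.smoothTransition (deriv Real.smoothTransition (ε * τ / ε - 1))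
      (ε * τ / ε - 1) :=
    ((Real.smoothTransition.contDiff (n := 1)).differentiable (by norm_num) _).hasDerivAt
  have h3 : HasDerivAt (cutoffProfile ε) _ (ε * τ) :=
    HasDerivAt.comp (h₂ := Real.smoothTransition) (h := fun s : ℝ => s / ε - 1) (ε * τ) h2 h1
  rw [h3.deriv, e1]
  field_simp

namespace IsInnerTube

variable {γ : ℝ → Plane} {σ δ ε : ℝ}

theorem pos_of_mem (h : IsInnerTube σ γ δ) {p : Plane} (hp : |p 1| < δ)
    (hmem : tubeMap σ γ p ∈ curveInterior γ) : 0 < p 1 := by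
  by_contra h0
  exact h.notMem_interior p (abs_lt.1 hp).1 (not_lt.1 h0) hmem

theorem cutoff_tubeMap (h : IsInnerTube σ γ δ) {p : Plane} (hp : |p 1| < δ) :
    cutoff σ γ δ ε (tubeMap σ γ p) = cutoffProfile ε (p 1) := by
  rw [cutoff, if_pos ⟨p, hp, rfl⟩, h.tubeCoord_tubeMap hp]

theorem cutoff_of_notMem_tube {y : Plane} (hy : y ∉ tube σ γ δ) :
    cutoff σ γ δ ε y = (curveInterior γ).indicator (fun _ => 1) y := by
  rw [cutoff, if_neg hy]

theorem abs_cutoff_le (y : Plane) : |cutoff σ γ δ ε y| ≤ 1 := by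
  classical
  unfold cutoff
  split_ifs
  · rw [cutoffProfile, abs_of_nonneg (Real.smoothTransition.nonneg _)]
    exact Real.smoothTransition.le_one _
  · rw [indicator_apply]; split_ifs <;> simp

theorem eventually_cutoff_eq_zero (h : IsInnerTube σ γ δ) (hγ : IsRegularSimpleClosedCurve γ)
    (hε : 0 < ε) {y : Plane} (hy : y ∉ curveInterior γ) : cutoff σ γ δ ε =ᶠ[𝓝 y] 0 := by
  by_cases hyU : y ∈ tube σ γ δ
  · obtain ⟨p, hp, rfl⟩ := hyU
    have h0 : p 1 ≤ 0 := by
      by_contra h0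
      exact hy (h.mem_interior p (not_le.1 h0) (abs_lt.1 hp).2)
    have : ∀ᶠ y in 𝓝 (tubeMap σ γ p), ∃ q : Plane, (|q 1| < δ ∧ q 1 < ε) ∧ tubeMap σ γ q = y := by
      rw [← h.map_nhds hγ hp]
      refine image_mem_map (IsOpen.mem_nhds ((isOpen_strip δ).inter
        (isOpen_lt (continuous_coord 1) continuous_const)) ⟨hp, h0.trans_lt hε⟩)
    filter_upwards [this]
    rintro _ ⟨q, ⟨hq, hq'⟩, rfl⟩
    rw [h.cutoff_tubeMap hq, cutoffProfile_eq_zero hε hq'.le]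
    rfl
  · have hyc : y ∉ closure (curveInterior γ) := by
      intro hyc
      rcases hγ.closure_curveInterior_subset hyc with hy' | ⟨t, rfl⟩
      · exact hy hy'
      · exact hyU ⟨!₂[t, 0], by simpa using h.pos, tubeMap_mk_zero σ γ t⟩
    have hnot : ∀ z ∈ tube σ γ δ, z ∉ closure (curveInterior γ) → cutoff σ γ δ ε z = 0 := by
      rintro _ ⟨p, hp, rfl⟩ hz
      rw [h.cutoff_tubeMap hp]
      refine cutoffProfile_eq_zero hε ?_
      by_contra h0
      exact hz (subset_closure (h.mem_interior p (hε.trans (not_le.1 h0)) (abs_lt.1 hp).2))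
    filter_upwards [isClosed_closure.isOpen_compl.mem_nhds hyc] with z hz
    by_cases hzU : z ∈ tube σ γ δ
    · exact hnot z hzU hz
    · rw [cutoff_of_notMem_tube hzU, indicator_of_notMem (fun h' => hz (subset_closure h'))]
      rfl

theorem eventually_cutoff_eq_one (h : IsInnerTube σ γ δ) (hγ : IsRegularSimpleClosedCurve γ)
    (hε : 0 < ε) (hεδ : 2 * ε < δ) {y : Plane} (hy : y ∈ curveInterior γ) (hyU : y ∉ tube σ γ δ) :
    cutoff σ γ δ ε =ᶠ[𝓝 y] fun _ => 1 := by
  let c : ℝ × ℝ → Plane := fun z => tubeMap σ γ !₂[z.1, z.2]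
  have hc : Continuous c := hγ.continuous_tubeMap.comp (by fun_prop)
  set C := c '' (Icc 0 1 ×ˢ Icc 0 (2 * ε)) with hC
  have hCc : IsCompact C := (isCompact_Icc.prod isCompact_Icc).image hc
  have hyC : y ∉ C := by
    rintro ⟨⟨t, s⟩, ⟨-, hs⟩, rfl⟩
    refine hyU ⟨!₂[t, s], ?_, rfl⟩
    have : |s| < δ := by rw [abs_of_nonneg hs.1]; exact hs.2.trans_lt hεδ
    simpa using this
  filter_upwards [hCc.isClosed.isOpen_compl.mem_nhds hyC, hγ.isOpen_curveInterior.mem_nhds hy]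
    with z hzC hzΩ
  by_cases hzU : z ∈ tube σ γ δ
  · obtain ⟨p, hp, rfl⟩ := hzU
    have h0 := h.pos_of_mem hp hzΩ
    rw [h.cutoff_tubeMap hp]
    refine cutoffProfile_eq_one hε ?_
    by_contra h2
    refine hzC ⟨(Int.fract (p 0), p 1), ⟨⟨Int.fract_nonneg _, (Int.fract_lt_one _).le⟩,
      h0.le, (not_le.1 h2).le⟩, ?_⟩
    refine hγ.tubeMap_eq_of_coe_eq (-⌊p 0⌋) ?_ rfl
    simp [Int.fract, sub_eq_add_neg]
  · rw [cutoff_of_notMem_tube hzU, indicator_of_mem hzΩ]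

theorem eventually_cutoff_eq_profile (h : IsInnerTube σ γ δ) (hγ : IsRegularSimpleClosedCurve γ)
    {p : Plane} (hp : |p 1| < δ) :
    cutoff σ γ δ ε =ᶠ[𝓝 (tubeMap σ γ p)] cutoffProfile ε ∘ tubeCoord σ γ δ := by
  filter_upwards [(h.isOpen_tube hγ).mem_nhds ⟨p, hp, rfl⟩] with z hz
  rw [cutoff, if_pos hz]; rfl

theorem contDiff_cutoff (h : IsInnerTube σ γ δ) (hγ : IsRegularSimpleClosedCurve γ)
    (hε : 0 < ε) (hεδ : 2 * ε < δ) : ContDiff ℝ 1 (cutoff σ γ δ ε) := by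
  rw [contDiff_iff_contDiffAt]
  intro y
  by_cases hyU : y ∈ tube σ γ δ
  · obtain ⟨p, hp, rfl⟩ := hyU
    exact ((contDiff_cutoffProfile ε).contDiffAt.comp _
      (h.contDiffAt_tubeCoord hγ hp)).congr_of_eventuallyEq (h.eventually_cutoff_eq_profile hγ hp)
  by_cases hy : y ∈ curveInterior γ
  · exact contDiffAt_const.congr_of_eventuallyEq (h.eventually_cutoff_eq_one hγ hε hεδ hy hyU)
  · exact contDiffAt_const.congr_of_eventuallyEq (h.eventually_cutoff_eq_zero hγ hε hy)

theorem tsupport_cutoff_subset (h : IsInnerTube σ γ δ) (hγ : IsRegularSimpleClosedCurve γ)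
    (hε : 0 < ε) : tsupport (cutoff σ γ δ ε) ⊆ curveInterior γ := by
  intro y hy
  by_contra hy'
  exact notMem_tsupport_iff_eventuallyEq.2 (h.eventually_cutoff_eq_zero hγ hε hy') hy

theorem hasCompactSupport_cutoff (h : IsInnerTube σ γ δ) (hγ : IsRegularSimpleClosedCurve γ)
    (hε : 0 < ε) : HasCompactSupport (cutoff σ γ δ ε) :=
  Metric.isCompact_of_isClosed_isBounded (isClosed_tsupport _)
    (hγ.isBounded_curveInterior.subset (h.tsupport_cutoff_subset hγ hε))

theorem fderiv_cutoff_tubeMap (h : IsInnerTube σ γ δ) (hγ : IsRegularSimpleClosedCurve γ)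
    {p : Plane} (hp : |p 1| < δ) :
    fderiv ℝ (cutoff σ γ δ ε) (tubeMap σ γ p) =
      deriv (cutoffProfile ε) (p 1) • fderiv ℝ (tubeCoord σ γ δ) (tubeMap σ γ p) := by
  rw [(h.eventually_cutoff_eq_profile hγ hp).fderiv_eq]
  have h1 : HasDerivAt (cutoffProfile ε) (deriv (cutoffProfile ε) (p 1))
      (tubeCoord σ γ δ (tubeMap σ γ p)) := by
    rw [h.tubeCoord_tubeMap hp]
    exact ((contDiff_cutoffProfile ε).differentiable (by norm_num) _).hasDerivAt
  exact (h1.comp_hasFDerivAt _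
    ((h.contDiffAt_tubeCoord hγ hp).differentiableAt one_ne_zero).hasFDerivAt).fderiv

/-- The gradient of the cutoff function is supported in a half tube of width `2 ε`. -/
theorem fderiv_cutoff_eq_zero (h : IsInnerTube σ γ δ) (hγ : IsRegularSimpleClosedCurve γ)
    (hε : 0 < ε) (hεδ : 2 * ε < δ) {y : Plane}
    (hy : y ∉ tubeMap σ γ '' {p | p 0 ∈ Ico 0 1 ∧ p 1 ∈ Ioc 0 (2 * ε)}) :
    fderiv ℝ (cutoff σ γ δ ε) y = 0 := by
  have key : ∀ c : ℝ, cutoff σ γ δ ε =ᶠ[𝓝 y] (fun _ => c) → fderiv ℝ (cutoff σ γ δ ε) y = 0 := by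
    intro c hc
    rw [hc.fderiv_eq]
    simp
  by_cases hyΩ : y ∈ curveInterior γ
  swap
  · exact key 0 (h.eventually_cutoff_eq_zero hγ hε hyΩ)
  by_cases hyU : y ∈ tube σ γ δ
  swap
  · exact key 1 (h.eventually_cutoff_eq_one hγ hε hεδ hyΩ hyU)
  obtain ⟨p, hp, rfl⟩ := hyU
  have h0 := h.pos_of_mem hp hyΩ
  have h2 : 2 * ε < p 1 := by
    by_contra h2
    refine hy ⟨!₂[Int.fract (p 0), p 1], ⟨⟨Int.fract_nonneg _, Int.fract_lt_one _⟩,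
      h0, not_lt.1 h2⟩, ?_⟩
    refine hγ.tubeMap_eq_of_coe_eq (-⌊p 0⌋) ?_ rfl
    simp [Int.fract, sub_eq_add_neg]
  have hd : deriv (cutoffProfile ε) (p 1) = 0 := by
    have : cutoffProfile ε =ᶠ[𝓝 (p 1)] fun _ => 1 := by
      filter_upwards [Ioi_mem_nhds h2] with s hs
      exact cutoffProfile_eq_one hε (le_of_lt hs)
    rw [this.deriv_eq]; simp
  rw [h.fderiv_cutoff_tubeMap hγ hp, hd, zero_smul]

theorem tendsto_cutoff (h : IsInnerTube σ γ δ) {y : Plane} (hy : y ∈ curveInterior γ) :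
    Tendsto (fun ε => cutoff σ γ δ ε y) (𝓝[>] 0) (𝓝 1) := by
  by_cases hyU : y ∈ tube σ γ δ
  · obtain ⟨p, hp, rfl⟩ := hyU
    have h0 := h.pos_of_mem hp hy
    refine tendsto_const_nhds.congr' ?_
    filter_upwards [Ioo_mem_nhdsGT (half_pos h0)] with ε hε
    rw [h.cutoff_tubeMap hp, cutoffProfile_eq_one hε.1 (by linarith [hε.2])]
  · simp only [cutoff_of_notMem_tube hyU, indicator_of_mem hy]
    exact tendsto_const_nhds

end IsInnerTube

/-! ### The divergence theorem in the interior of a curve -/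

/-- The divergence of a covector field on the plane. -/
def divergence (L : Plane → Plane →L[ℝ] ℝ) (y : Plane) : ℝ :=
  ∑ i, fderiv ℝ L y (e i) (e i)

/-- The total derivative of a compactly supported `C¹` function in a fixed direction integrates
to zero. -/
theorem integral_fderiv_apply_eq_zero {f : Plane → ℝ} (hf : ContDiff ℝ 1 f)
    (hc : HasCompactSupport f) (v : Plane) : ∫ y, fderiv ℝ f y v = 0 := by
  have hd : Continuous fun y => fderiv ℝ f y v :=
    (hf.continuous_fderiv (by norm_num)).clm_apply continuous_const
  have := integral_mul_fderiv_eq_neg_fderiv_mul_of_integrable (μ := (volume : Measure Plane))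
    (f := fun _ : Plane => (1 : ℝ)) (g := f) (v := v) (by simp)
    (by simpa using hd.integrable_of_hasCompactSupport (hc.fderiv_apply ℝ v))
    (by simpa using hf.continuous.integrable_of_hasCompactSupport hc)
    (fun y _ => differentiableAt_const _) (fun y _ => hf.differentiable (by norm_num) y)
  simpa using this

theorem eventually_mul_eq_zero {ψ : Plane → ℝ} {y : Plane} (hy : y ∉ tsupport ψ)
    (g : Plane → ℝ) : (fun z => ψ z * g z) =ᶠ[𝓝 y] fun _ => 0 := by
  filter_upwards [notMem_tsupport_iff_eventuallyEq.1 hy] with z hz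
  simp [hz]

/-- Integration by parts against a compactly supported function in an open set. -/
theorem integral_fderiv_mul_eq_neg {U : Set Plane} (hU : IsOpen U) {L : Plane → Plane →L[ℝ] ℝ}
    (hL : ContDiffOn ℝ 1 L U) {ψ : Plane → ℝ} (hψ : ContDiff ℝ 1 ψ) (hc : HasCompactSupport ψ)
    (hs : tsupport ψ ⊆ U) :
    ∫ y, ∑ i, fderiv ℝ ψ y (e i) * L y (e i) = -∫ y, ψ y * divergence L y := by
  have hLat {y : Plane} (hy : y ∈ tsupport ψ) : ContDiffAt ℝ 1 L y :=
    hL.contDiffAt (hU.mem_nhds (hs hy))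
  have hDL : ContinuousOn (fderiv ℝ L) U := hL.continuousOn_fderiv_of_isOpen hU le_rfl
  have hDat {y : Plane} (hy : y ∈ tsupport ψ) : ContinuousAt (fderiv ℝ L) y :=
    hDL.continuousAt (hU.mem_nhds (hs hy))
  have hDψ (i : Fin 2) : Continuous fun y => fderiv ℝ ψ y (e i) :=
    (hψ.continuous_fderiv (by norm_num)).clm_apply continuous_const
  have hA (i : Fin 2) : ContDiff ℝ 1 fun y => ψ y * L y (e i) := by
    rw [contDiff_iff_contDiffAt]
    intro y
    by_cases hy : y ∈ tsupport ψ
    · exact hψ.contDiffAt.mul ((hLat hy).clm_apply contDiffAt_const)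
    · exact contDiffAt_const.congr_of_eventuallyEq (eventually_mul_eq_zero hy _)
  have hAc (i : Fin 2) : HasCompactSupport fun y => ψ y * L y (e i) := hc.mul_right
  have hB (i : Fin 2) : Integrable fun y => fderiv ℝ ψ y (e i) * L y (e i) := by
    refine Continuous.integrable_of_hasCompactSupport (continuous_of_tsupport fun y hy => ?_)
      (hc.fderiv_apply ℝ (e i)).mul_right
    have hy' := tsupport_fderiv_apply_subset ℝ (e i) (tsupport_mul_subset_left
      (f := fun y => fderiv ℝ ψ y (e i)) (g := fun y => L y (e i)) hy)
    exact (hDψ i).continuousAt.mul ((hLat hy').continuousAt.clm_apply continuousAt_const)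
  have hC (i : Fin 2) : Integrable fun y => ψ y * fderiv ℝ L y (e i) (e i) := by
    refine Continuous.integrable_of_hasCompactSupport (continuous_of_tsupport fun y hy => ?_)
      hc.mul_right
    have hy' := tsupport_mul_subset_left (f := ψ) (g := fun y => fderiv ℝ L y (e i) (e i)) hy
    exact hψ.continuous.continuousAt.mul
      (((hDat hy').clm_apply continuousAt_const).clm_apply continuousAt_const)
  have hder (i : Fin 2) (y : Plane) : fderiv ℝ (fun y => ψ y * L y (e i)) y (e i) =
      ψ y * fderiv ℝ L y (e i) (e i) + fderiv ℝ ψ y (e i) * L y (e i) := by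
    by_cases hy : y ∈ tsupport ψ
    · have h1 : HasFDerivAt (fun y => ψ y * L y (e i)) _ y :=
        (hψ.differentiable (by norm_num) y).hasFDerivAt.mul
          (((hLat hy).differentiableAt (by norm_num)).hasFDerivAt.clm_apply
            (hasFDerivAt_const (e i) y))
      rw [h1.fderiv]
      simp [mul_comm]
    · rw [(eventually_mul_eq_zero hy _).fderiv_eq,
        (notMem_tsupport_iff_eventuallyEq.1 hy).fderiv_eq,
        (notMem_tsupport_iff_eventuallyEq.1 hy).self_of_nhds]
      simp
  have hzero (i : Fin 2) : (∫ y, fderiv ℝ ψ y (e i) * L y (e i)) =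
      -∫ y, ψ y * fderiv ℝ L y (e i) (e i) := by
    have := integral_fderiv_apply_eq_zero (hA i) (hAc i) (e i)
    simp_rw [hder i] at this
    rw [integral_add (hC i) (hB i)] at this
    linarith
  rw [integral_finsetSum _ fun i _ => hB i, Finset.sum_congr rfl fun i _ => hzero i]
  simp_rw [divergence, Finset.mul_sum]
  rw [integral_finsetSum _ fun i _ => hC i, Finset.sum_neg_distrib]

/-- Integrals over rectangles of the plane as integrals over a product. -/
theorem setIntegral_plane_eq_prod (f : Plane → ℝ) (A B : Set ℝ) :
    ∫ p in {p : Plane | p 0 ∈ A ∧ p 1 ∈ B}, f p = ∫ z in A ×ˢ B, f !₂[z.1, z.2] := by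
  have hm : MeasurePreserving (MeasurableEquiv.finTwoArrow.symm.trans
      (MeasurableEquiv.toLp 2 (Fin 2 → ℝ))) (volume : Measure (ℝ × ℝ)) volume :=
    (volume_preserving_finTwoArrow ℝ).symm.trans
      (EuclideanSpace.volume_preserving_symm_measurableEquiv_toLp (Fin 2)).symm
  exact (hm.setIntegral_preimage_emb (MeasurableEquiv.measurableEmbedding _) f
    {p : Plane | p 0 ∈ A ∧ p 1 ∈ B}).symm

/-- The linear map `(t, τ) ↦ (t, ε τ)`, which rescales the normal coordinate. -/
def squeeze (ε : ℝ) : Plane →L[ℝ] Plane := ofColumns (e 0) (ε • e 1)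

@[simp] theorem squeeze_apply_zero (ε : ℝ) (p : Plane) : squeeze ε p 0 = p 0 := by
  simp [squeeze, e]

@[simp] theorem squeeze_apply_one (ε : ℝ) (p : Plane) : squeeze ε p 1 = ε * p 1 := by
  simp [squeeze, e, mul_comm]

/-- The rectangle `[0, 1) × (0, 2]`. For small `ε` the tube map composed with `squeeze ε` is
injective on it, and its image contains the support of the gradient of the cutoff function. -/
def paramRect : Set Plane := {p | p 0 ∈ Ico (0 : ℝ) 1 ∧ p 1 ∈ Ioc (0 : ℝ) 2}

theorem measurableSet_paramRect : MeasurableSet paramRect :=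
  ((continuous_coord 0).measurable measurableSet_Ico).inter
    ((continuous_coord 1).measurable measurableSet_Ioc)

theorem volume_paramRect_lt_top : volume paramRect < ⊤ := by
  refine (Bornology.IsBounded.measure_lt_top ?_)
  rw [isBounded_iff_forall_norm_le]
  refine ⟨3, fun p hp => ?_⟩
  have h1 := norm_sq_eq_coords p
  obtain ⟨⟨a, b⟩, c, d⟩ := hp
  nlinarith [norm_nonneg p]

/-- The rows of the cofactor matrix: `∑ cross a eᵢ • eᵢ` is the rotation of `a` by `π/2`. -/
theorem sum_cross_mul (a : Plane) (l : Plane →L[ℝ] ℝ) :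
    ∑ i, cross a (e i) * l (e i) = -l (rot a) := by
  have : rot a = a 1 • e 0 - a 0 • e 1 := by
    ext i; fin_cases i <;> simp [e]
  rw [this, map_sub, map_smul, map_smul]
  simp [Fin.sum_univ_two, cross, e]
  ring

namespace IsInnerTube

variable {γ : ℝ → Plane} {σ δ ε : ℝ}

theorem abs_squeeze_lt (hε : 0 < ε) (hεδ : 2 * ε < δ) {p : Plane}
    (hp : p ∈ paramRect) : |squeeze ε p 1| < δ := by
  have := hp.2
  rw [squeeze_apply_one, abs_of_pos (mul_pos hε this.1)]
  nlinarith [this.2]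

/-- The change of variables by the tube map in the integral of a field against the gradient of
the cutoff function. -/
theorem integral_fderiv_cutoff_mul (h : IsInnerTube σ γ δ) (hγ : IsRegularSimpleClosedCurve γ)
    (hε : 0 < ε) (hεδ : 2 * ε < δ) (L : Plane → Plane →L[ℝ] ℝ) :
    ∫ y, ∑ i, fderiv ℝ (cutoff σ γ δ ε) y (e i) * L y (e i) =
      -∫ p in paramRect, deriv Real.smoothTransition (p 1 - 1) *
        L (tubeMap σ γ (squeeze ε p)) (σ • rot (tubeTangent σ γ (squeeze ε p))) := by
  set f : Plane → Plane := fun p => tubeMap σ γ (squeeze ε p) with hf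
  have himage : f '' paramRect = tubeMap σ γ '' {p | p 0 ∈ Ico 0 1 ∧ p 1 ∈ Ioc 0 (2 * ε)} := by
    ext y
    constructor
    · rintro ⟨p, ⟨hp0, hp1⟩, rfl⟩
      refine ⟨squeeze ε p, ⟨by simpa using hp0, ?_⟩, rfl⟩
      rw [squeeze_apply_one]
      exact ⟨mul_pos hε hp1.1, by nlinarith [hp1.2]⟩
    · rintro ⟨p, ⟨hp0, hp1⟩, rfl⟩
      refine ⟨!₂[p 0, p 1 / ε], ⟨hp0, ?_⟩, ?_⟩
      · exact ⟨div_pos hp1.1 hε, (div_le_iff₀ hε).2 hp1.2⟩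
      · simp only [hf]
        congr 1
        ext i
        fin_cases i
        · simp
        · simp; field_simp
  have hder : ∀ p ∈ paramRect, HasFDerivWithinAt f
      (ofColumns (tubeTangent σ γ (squeeze ε p)) (ε • -normalField σ γ (p 0))) paramRect p := by
    intro p _
    refine HasFDerivAt.hasFDerivWithinAt ?_
    refine ((hγ.hasFDerivAt_tubeMap (σ := σ) (squeeze ε p)).comp p
      (squeeze ε).hasFDerivAt).congr_fderiv ?_
    ext v i
    simp [tubeDeriv]
    ring
  have hinj : InjOn f paramRect := by
    intro p hp q hq hpq
    obtain ⟨⟨k, hk⟩, h1⟩ := h.injective _ _ (abs_squeeze_lt hε hεδ hp)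
      (abs_squeeze_lt hε hεδ hq) hpq
    simp only [squeeze_apply_zero, squeeze_apply_one] at hk h1
    have hk0 : k = 0 := by
      have h2 : (k : ℝ) < 1 := by linarith [hp.1.2, hq.1.1]
      have h3 : (-1 : ℝ) < k := by linarith [hp.1.1, hq.1.2]
      have h2' : k < 1 := by exact_mod_cast h2
      have h3' : -1 < k := by exact_mod_cast h3
      omega
    ext i
    fin_cases i
    · simpa [hk0] using hk
    · exact mul_left_cancel₀ hε.ne' h1
  rw [← setIntegral_eq_integral_of_forall_compl_eq_zero (s := f '' paramRect) (fun y hy => by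
      rw [himage] at hy
      rw [h.fderiv_cutoff_eq_zero hγ hε hεδ hy]; simp),
    integral_image_eq_integral_abs_det_fderiv_smul volume measurableSet_paramRect hder hinj,
    ← integral_neg]
  refine setIntegral_congr_fun measurableSet_paramRect fun p hp => ?_
  have hp' := abs_squeeze_lt hε hεδ hp
  have hcr := h.cross_pos _ hp'
  have hσ : |σ| = 1 := by rcases sq_eq_one_iff.1 h.sign with rfl | rfl <;> simp
  set a := tubeTangent σ γ (squeeze ε p) with ha
  have hdet : |(ofColumns a (ε • -normalField σ γ (p 0))).det| =
      ε * (σ * cross a (-normalField σ γ (squeeze ε p 0))) := by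
    rw [det_ofColumns, squeeze_apply_zero] at *
    have : cross a (ε • -normalField σ γ (p 0)) = ε * cross a (-normalField σ γ (p 0)) := by
      simp [cross]; ring
    rw [this, abs_mul, abs_of_pos hε, ← abs_of_pos hcr, abs_mul,
      hσ, one_mul]
  have hsum : ∑ i, fderiv ℝ (tubeCoord σ γ δ) (f p) (e i) * L (f p) (e i) *
      cross a (-normalField σ γ (squeeze ε p 0)) = -L (f p) (rot a) := by
    rw [← sum_cross_mul]
    refine Finset.sum_congr rfl fun i _ => ?_
    rw [← h.fderiv_tubeCoord_mul_cross hγ hp' (e i)]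
    ring
  have hfd := h.fderiv_cutoff_tubeMap (ε := ε) hγ hp'
  simp only [smul_eq_mul]
  rw [hdet, ← deriv_cutoffProfile_mul hε, map_smul, smul_eq_mul]
  rw [← Finset.sum_mul] at hsum
  simp only [hf] at hsum ⊢
  rw [hfd]
  simp only [_root_.smul_apply, smul_eq_mul, mul_assoc, ← Finset.mul_sum,
    squeeze_apply_one] at hsum ⊢
  linear_combination (ε * σ * deriv (cutoffProfile ε) (ε * p 1)) * hsum

theorem isCompact_closure (hγ : IsRegularSimpleClosedCurve γ) :
    IsCompact (closure (curveInterior γ)) :=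
  hγ.isBounded_curveInterior.isCompact_closure

theorem squeeze_mem_closure (h : IsInnerTube σ γ δ) (hε : 0 < ε) (hεδ : 2 * ε < δ) {p : Plane}
    (hp : p ∈ paramRect) : tubeMap σ γ (squeeze ε p) ∈ closure (curveInterior γ) := by
  refine h.tubeMap_mem_closure ?_ (abs_lt.1 (abs_squeeze_lt hε hεδ hp)).2
  rw [squeeze_apply_one]
  exact (mul_pos hε hp.2.1).le

/-- The flux through the half tube of width `2 ε`, averaged by the cutoff function, tends to the
flux through the curve. -/
theorem tendsto_integral_paramRect (h : IsInnerTube σ γ δ) (hγ : IsRegularSimpleClosedCurve γ)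
    {L : Plane → Plane →L[ℝ] ℝ} (hc : ContinuousOn L (closure (curveInterior γ))) :
    Tendsto (fun ε => ∫ p in paramRect, deriv Real.smoothTransition (p 1 - 1) *
        L (tubeMap σ γ (squeeze ε p)) (σ • rot (tubeTangent σ γ (squeeze ε p)))) (𝓝[>] 0)
      (𝓝 (∫ p in paramRect, deriv Real.smoothTransition (p 1 - 1) *
        L (γ (p 0)) (normalField σ γ (p 0)))) := by
  have hst : Continuous (deriv Real.smoothTransition) :=
    (Real.smoothTransition.contDiff (n := 1)).continuous_deriv le_rfl
  obtain ⟨M, hM⟩ := (isCompact_closure hγ).exists_bound_of_continuousOn hc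
  obtain ⟨M₁, hM₁0, hM₁⟩ := exists_norm_le_of_periodic hγ.continuous_deriv
    (periodic_deriv hγ.periodic)
  obtain ⟨M₂, hM₂0, hM₂⟩ := exists_norm_le_of_periodic
    ((hγ.contDiff_normalField (σ := σ)).continuous_deriv le_rfl)
    (periodic_deriv (hγ.periodic_normalField (σ := σ)))
  obtain ⟨M₃, hM₃⟩ := (isCompact_Icc (a := (-1 : ℝ)) (b := 1)).exists_bound_of_continuousOn
    hst.continuousOn
  have hsmall : ∀ᶠ ε in 𝓝[>] (0 : ℝ), 0 < ε ∧ 2 * ε < δ := by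
    filter_upwards [Ioo_mem_nhdsGT (half_pos h.pos)] with ε hε
    exact ⟨hε.1, by linarith [hε.2]⟩
  refine tendsto_integral_filter_of_dominated_convergence
    (fun _ => M₃ * (M * (|σ| * (M₁ + δ * M₂)))) ?_ ?_ ?_ ?_
  · filter_upwards [hsmall] with ε hε
    refine ContinuousOn.aestronglyMeasurable ?_ measurableSet_paramRect
    refine ContinuousOn.mul ?_ (ContinuousOn.clm_apply ?_ ?_)
    · exact (hst.comp ((continuous_coord 1).sub continuous_const)).continuousOn
    · exact hc.comp (hγ.continuous_tubeMap.comp (squeeze ε).continuous).continuousOn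
        fun p hp => h.squeeze_mem_closure hε.1 hε.2 hp
    · exact ((rot.continuous.comp (hγ.continuous_tubeTangent.comp
        (squeeze ε).continuous)).const_smul σ).continuousOn
  · filter_upwards [hsmall] with ε hε
    filter_upwards [ae_restrict_mem measurableSet_paramRect] with p hp
    have h1 : ‖deriv Real.smoothTransition (p 1 - 1)‖ ≤ M₃ :=
      hM₃ _ ⟨by linarith [hp.2.1], by linarith [hp.2.2]⟩
    have h2 : ‖tubeTangent σ γ (squeeze ε p)‖ ≤ M₁ + δ * M₂ := by
      refine (norm_sub_le _ _).trans (add_le_add (hM₁ _) ?_)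
      rw [norm_smul]
      exact mul_le_mul (abs_squeeze_lt hε.1 hε.2 hp).le (hM₂ _) (norm_nonneg _) h.pos.le
    have h3 := hM _ (h.squeeze_mem_closure hε.1 hε.2 hp)
    rw [norm_mul]
    refine mul_le_mul h1 ?_ (norm_nonneg _) ((norm_nonneg _).trans h1)
    refine (ContinuousLinearMap.le_opNorm _ _).trans ?_
    refine mul_le_mul h3 ?_ (norm_nonneg _) ((norm_nonneg _).trans h3)
    rw [norm_smul, norm_rot, Real.norm_eq_abs]
    gcongr
  · have : IsFiniteMeasure ((volume : Measure Plane).restrict paramRect) :=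
      ⟨by simpa using volume_paramRect_lt_top⟩
    exact integrable_const _
  · filter_upwards [ae_restrict_mem measurableSet_paramRect] with p hp
    have hsq : Tendsto (fun ε : ℝ => squeeze ε p) (𝓝[>] 0) (𝓝 (squeeze 0 p)) := by
      have : Continuous fun ε : ℝ => squeeze ε p := by
        simp only [squeeze, ofColumns_apply]; fun_prop
      exact (this.tendsto 0).mono_left nhdsWithin_le_nhds
    have hT0 : tubeMap σ γ (squeeze 0 p) = γ (p 0) := by simp [tubeMap]
    have ht0 : tubeTangent σ γ (squeeze 0 p) = deriv γ (p 0) := by simp [tubeTangent]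
    have h1 : Tendsto (fun ε => tubeMap σ γ (squeeze ε p)) (𝓝[>] 0)
        (𝓝[closure (curveInterior γ)] (γ (p 0))) := by
      rw [← hT0]
      refine tendsto_nhdsWithin_iff.2 ⟨(hγ.continuous_tubeMap.tendsto _).comp hsq, ?_⟩
      filter_upwards [hsmall] with ε hε
      exact h.squeeze_mem_closure hε.1 hε.2 hp
    have h2 : Tendsto (fun ε => L (tubeMap σ γ (squeeze ε p))) (𝓝[>] 0) (𝓝 (L (γ (p 0)))) :=
      (hc (γ (p 0)) (h.range_subset_closure ⟨_, rfl⟩)).tendsto.comp h1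
    have h3 := (hγ.continuous_tubeTangent (σ := σ)).tendsto (squeeze 0 p) |>.comp hsq
    rw [ht0] at h3
    have h4 : Tendsto (fun ε => σ • rot (tubeTangent σ γ (squeeze ε p))) (𝓝[>] 0)
        (𝓝 (normalField σ γ (p 0))) := ((rot.continuous.tendsto _).comp h3).const_smul σ
    exact (((isBoundedBilinearMap_apply (𝕜 := ℝ) (E := Plane) (F := ℝ)).continuous.tendsto
      (L (γ (p 0)), normalField σ γ (p 0))).comp (h2.prodMk_nhds h4)).const_mul _

theorem integral_deriv_smoothTransition :
    ∫ τ in Ioc (0 : ℝ) 2, deriv Real.smoothTransition (τ - 1) = 1 := by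
  have hst : Continuous (deriv Real.smoothTransition) :=
    (Real.smoothTransition.contDiff (n := 1)).continuous_deriv le_rfl
  rw [← intervalIntegral.integral_of_le (by norm_num),
    intervalIntegral.integral_comp_sub_right (fun τ => deriv Real.smoothTransition τ),
    intervalIntegral.integral_deriv_eq_sub
      (fun x _ => (Real.smoothTransition.contDiff (n := 1)).differentiable (by norm_num) x)
      (hst.intervalIntegrable _ _),
    Real.smoothTransition.one_of_one_le (by norm_num),
    Real.smoothTransition.zero_of_nonpos (by norm_num)]
  norm_num

/-- The divergence theorem in the interior of a regular simple closed curve, for covector fields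
that are continuous up to the boundary and of class `C¹` inside. -/
theorem integral_divergence_eq (h : IsInnerTube σ γ δ) (hγ : IsRegularSimpleClosedCurve γ)
    {L : Plane → Plane →L[ℝ] ℝ} (hc : ContinuousOn L (closure (curveInterior γ)))
    (hL : ContDiffOn ℝ 1 L (curveInterior γ))
    (hint : IntegrableOn (divergence L) (curveInterior γ)) :
    ∫ y in curveInterior γ, divergence L y = ∫ t in (0 : ℝ)..1, L (γ t) (normalField σ γ t) := by
  have hΩm : MeasurableSet (curveInterior γ) := hγ.isOpen_curveInterior.measurableSet
  have hsmall : ∀ᶠ ε in 𝓝[>] (0 : ℝ), 0 < ε ∧ 2 * ε < δ := by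
    filter_upwards [Ioo_mem_nhdsGT (half_pos h.pos)] with ε hε
    exact ⟨hε.1, by linarith [hε.2]⟩
  have hA : Tendsto (fun ε => ∫ y in curveInterior γ, cutoff σ γ δ ε y * divergence L y) (𝓝[>] 0)
      (𝓝 (∫ y in curveInterior γ, divergence L y)) := by
    refine tendsto_integral_filter_of_dominated_convergence (fun y => ‖divergence L y‖) ?_ ?_
      hint.norm ?_
    · filter_upwards [hsmall] with ε hε
      exact (h.contDiff_cutoff hγ hε.1 hε.2).continuous.aestronglyMeasurable.mul
        hint.aestronglyMeasurable
    · refine Eventually.of_forall fun ε => Eventually.of_forall fun y => ?_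
      rw [norm_mul]
      exact mul_le_of_le_one_left (norm_nonneg _) (abs_cutoff_le y)
    · filter_upwards [ae_restrict_mem hΩm] with y hy
      simpa using (h.tendsto_cutoff hy).mul_const (divergence L y)
  have hB : ∀ᶠ ε in 𝓝[>] (0 : ℝ), (∫ p in paramRect, deriv Real.smoothTransition (p 1 - 1) *
        L (tubeMap σ γ (squeeze ε p)) (σ • rot (tubeTangent σ γ (squeeze ε p)))) =
      ∫ y in curveInterior γ, cutoff σ γ δ ε y * divergence L y := by
    filter_upwards [hsmall] with ε hε
    have h1 := integral_fderiv_mul_eq_neg hγ.isOpen_curveInterior hL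
      (h.contDiff_cutoff hγ hε.1 hε.2) (h.hasCompactSupport_cutoff hγ hε.1)
      (h.tsupport_cutoff_subset hγ hε.1)
    rw [h.integral_fderiv_cutoff_mul hγ hε.1 hε.2, neg_inj] at h1
    rw [h1, setIntegral_eq_integral_of_forall_compl_eq_zero]
    intro y hy
    rw [(h.eventually_cutoff_eq_zero hγ hε.1 hy).self_of_nhds]
    simp
  rw [tendsto_nhds_unique hA ((h.tendsto_integral_paramRect hγ hc).congr' hB)]
  have hp := setIntegral_plane_eq_prod (fun p => deriv Real.smoothTransition (p 1 - 1) *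
        L (γ (p 0)) (normalField σ γ (p 0))) (Ico 0 1) (Ioc 0 2)
  have hm := setIntegral_prod_mul (μ := (volume : Measure ℝ)) (ν := (volume : Measure ℝ))
    (fun t => L (γ t) (normalField σ γ t))
    (fun τ => deriv Real.smoothTransition (τ - 1)) (Ico 0 1) (Ioc 0 2)
  rw [integral_deriv_smoothTransition, mul_one] at hm
  rw [intervalIntegral.integral_of_le zero_le_one, ← integral_Ico_eq_integral_Ioc, ← hm]
  refine hp.trans ?_
  simp only [Measure.volume_eq_prod]
  refine integral_congr_ae (Eventually.of_forall fun z => ?_)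
  simp [mul_comm]

end IsInnerTube

/-! ### Green's second identity -/

theorem laplacian_eq_divergence (f : Plane → ℝ) (y : Plane) :
    Laplacian.laplacian f y = divergence (fderiv ℝ f) y := by
  have := congrFun (InnerProductSpace.laplacian_eq_iteratedFDeriv_orthonormalBasis f
    (EuclideanSpace.basisFun (Fin 2) ℝ)) y
  rw [this, divergence]
  simp [iteratedFDeriv_two_apply, e]

theorem continuousOn_laplacian {U : Set Plane} (hU : IsOpen U) {f : Plane → ℝ}
    (hf : ContDiffOn ℝ 2 f U) : ContinuousOn (Laplacian.laplacian f) U := by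
  have h1 : ContDiffOn ℝ 1 (fderiv ℝ f) U := hf.fderiv_of_isOpen hU (by norm_num)
  have h2 : ContinuousOn (fderiv ℝ (fderiv ℝ f)) U := h1.continuousOn_fderiv_of_isOpen hU le_rfl
  have : Laplacian.laplacian f = divergence (fderiv ℝ f) := funext (laplacian_eq_divergence f)
  rw [this]
  exact continuousOn_finsetSum _ fun i _ =>
    (h2.clm_apply continuousOn_const).clm_apply continuousOn_const

/-- The covector field `φ du - u dφ`, where `du` is the derivative of `u` within the closed set
`K`. -/
def greenField (K : Set Plane) (u φ : Plane → ℝ) (y : Plane) : Plane →L[ℝ] ℝ :=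
  φ y • fderivWithin ℝ u K y - u y • fderiv ℝ φ y

namespace IsInnerTube

variable {γ : ℝ → Plane} {σ δ : ℝ} {u φ : Plane → ℝ}

theorem divergence_greenField (hγ : IsRegularSimpleClosedCurve γ)
    (hu : ContDiffOn ℝ 2 u (curveInterior γ)) (hφ : ContDiff ℝ 2 φ) {y : Plane}
    (hy : y ∈ curveInterior γ) :
    divergence (greenField (closure (curveInterior γ)) u φ) y =
      φ y * Laplacian.laplacian u y - u y * Laplacian.laplacian φ y := by
  have hΩ := hγ.isOpen_curveInterior
  have hev : greenField (closure (curveInterior γ)) u φ =ᶠ[𝓝 y]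
      fun z => φ z • fderiv ℝ u z - u z • fderiv ℝ φ z := by
    filter_upwards [hΩ.mem_nhds hy] with z hz
    rw [greenField, fderivWithin_of_mem_nhds (mem_of_superset (hΩ.mem_nhds hz) subset_closure)]
  have h1 := ((hφ.differentiable (by norm_num)) y).hasFDerivAt
  have h2 := ((hu.contDiffAt (hΩ.mem_nhds hy)).differentiableAt (by norm_num)).hasFDerivAt
  have h3 := (((hu.fderiv_of_isOpen hΩ (m := 1) (by norm_num)).contDiffAt
    (hΩ.mem_nhds hy)).differentiableAt (by norm_num)).hasFDerivAt
  have h4 := ((hφ.fderiv_right (m := 1) (by norm_num)).differentiable (by norm_num) y).hasFDerivAt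
  have h5 : HasFDerivAt (fun z => φ z • fderiv ℝ u z - u z • fderiv ℝ φ z) _ y :=
    (h1.smul h3).sub (h2.smul h4)
  simp only [laplacian_eq_divergence, divergence]
  rw [hev.fderiv_eq, h5.fderiv]
  simp only [Fin.sum_univ_two, _root_.sub_apply, _root_.add_apply, _root_.smul_apply, smul_eq_mul,
    ContinuousLinearMap.smulRight_apply]
  ring

theorem contDiffOn_greenField (hγ : IsRegularSimpleClosedCurve γ)
    (hu : ContDiffOn ℝ 2 u (curveInterior γ)) (hφ : ContDiff ℝ 2 φ) :
    ContDiffOn ℝ 1 (greenField (closure (curveInterior γ)) u φ) (curveInterior γ) := by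
  have hΩ := hγ.isOpen_curveInterior
  have h1 : ContDiffOn ℝ 1 (fun z => φ z • fderiv ℝ u z - u z • fderiv ℝ φ z)
      (curveInterior γ) :=
    ((hφ.of_le (by norm_num)).contDiffOn.smul (hu.fderiv_of_isOpen hΩ (by norm_num))).sub
      ((hu.of_le (by norm_num)).smul (hφ.fderiv_right (m := 1) (by norm_num)).contDiffOn)
  refine h1.congr fun z hz => ?_
  rw [greenField, fderivWithin_of_mem_nhds (mem_of_superset (hΩ.mem_nhds hz) subset_closure)]

/-- A function of class `C²` inside whose Laplacian is bounded has an integrable Laplacian. -/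
theorem integrableOn_laplacian (hγ : IsRegularSimpleClosedCurve γ)
    (hu : ContDiffOn ℝ 2 u (curveInterior γ))
    (hb : ∃ M : ℝ, ∀ y ∈ curveInterior γ, |Laplacian.laplacian u y| ≤ M) :
    IntegrableOn (Laplacian.laplacian u) (curveInterior γ) := by
  obtain ⟨M, hM⟩ := hb
  have hΩ := hγ.isOpen_curveInterior
  refine IntegrableOn.of_bound hγ.isBounded_curveInterior.measure_lt_top
    ((continuousOn_laplacian hΩ hu).aestronglyMeasurable hΩ.measurableSet) M ?_
  filter_upwards [ae_restrict_mem hΩ.measurableSet] with y hy using hM y hy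

/-- The product of an integrable function with a function that is continuous on the closure. -/
theorem integrableOn_mul_of_continuousOn (hγ : IsRegularSimpleClosedCurve γ) {f g : Plane → ℝ}
    (hf : ContinuousOn f (closure (curveInterior γ))) (hg : IntegrableOn g (curveInterior γ)) :
    IntegrableOn (fun y => f y * g y) (curveInterior γ) := by
  have hΩ := hγ.isOpen_curveInterior
  obtain ⟨M, hM⟩ := (isCompact_closure hγ).exists_bound_of_continuousOn hf
  refine Integrable.bdd_mul (c := M) hg
    ((hf.mono subset_closure).aestronglyMeasurable hΩ.measurableSet) ?_
  filter_upwards [ae_restrict_mem hΩ.measurableSet] with y hy using hM y (subset_closure hy)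

theorem integrableOn_of_continuousOn (hγ : IsRegularSimpleClosedCurve γ) {f : Plane → ℝ}
    (hf : ContinuousOn f (closure (curveInterior γ))) : IntegrableOn f (curveInterior γ) :=
  (hf.integrableOn_compact (isCompact_closure hγ)).mono_set subset_closure

theorem continuous_laplacian (hφ : ContDiff ℝ 2 φ) : Continuous (Laplacian.laplacian φ) :=
  continuousOn_univ.1 (continuousOn_laplacian isOpen_univ hφ.contDiffOn)

/-- Green's second identity in the interior of a curve, for a function `u` with bounded Laplacian
and a function `φ` that is `C²` on the whole plane. -/
theorem green_second_identity (h : IsInnerTube σ γ δ) (hγ : IsRegularSimpleClosedCurve γ)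
    (hu : ContDiffOn ℝ 2 u (curveInterior γ)) (hu' : ContDiffOn ℝ 1 u (closure (curveInterior γ)))
    (hb : ∃ M : ℝ, ∀ y ∈ curveInterior γ, |Laplacian.laplacian u y| ≤ M) (hφ : ContDiff ℝ 2 φ) :
    (∫ y in curveInterior γ, φ y * Laplacian.laplacian u y) -
        ∫ y in curveInterior γ, u y * Laplacian.laplacian φ y =
      ∫ t in (0 : ℝ)..1, (φ (γ t) *
          fderivWithin ℝ u (closure (curveInterior γ)) (γ t) (normalField σ γ t) -
        u (γ t) * fderiv ℝ φ (γ t) (normalField σ γ t)) := by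
  have hΩ := hγ.isOpen_curveInterior
  have hDu : ContinuousOn (fderivWithin ℝ u (closure (curveInterior γ)))
      (closure (curveInterior γ)) :=
    hu'.continuousOn_fderivWithin (h.uniqueDiffOn_closure hγ) le_rfl
  have hI1 : IntegrableOn (fun y => φ y * Laplacian.laplacian u y) (curveInterior γ) :=
    integrableOn_mul_of_continuousOn hγ hφ.continuous.continuousOn
      (integrableOn_laplacian hγ hu hb)
  have hI2 : IntegrableOn (fun y => u y * Laplacian.laplacian φ y) (curveInterior γ) :=
    integrableOn_of_continuousOn hγ (hu'.continuousOn.mul (continuous_laplacian hφ).continuousOn)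
  have hdiv : EqOn (fun y => φ y * Laplacian.laplacian u y - u y * Laplacian.laplacian φ y)
      (divergence (greenField (closure (curveInterior γ)) u φ)) (curveInterior γ) :=
    fun y hy => (divergence_greenField hγ hu hφ hy).symm
  have hc : ContinuousOn (greenField (closure (curveInterior γ)) u φ)
      (closure (curveInterior γ)) :=
    (hφ.continuous.continuousOn.smul hDu).sub
      (hu'.continuousOn.smul (hφ.continuous_fderiv (by norm_num)).continuousOn)
  rw [← integral_sub hI1 hI2, setIntegral_congr_fun hΩ.measurableSet hdiv,
    h.integral_divergence_eq hγ hc (contDiffOn_greenField hγ hu hφ)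
      (((hI1.sub hI2).congr_fun hdiv hΩ.measurableSet))]
  simp [greenField]

end IsInnerTube

/-! ### The regularized fundamental solution -/

/-- The regularization `-(1/4π) log (|y - x|² + r²)` of `y ↦ Φ (x - y)`. -/
def regKernel (x : Plane) (r : ℝ) (y : Plane) : ℝ :=
  -(1 / (4 * Real.pi)) * Real.log (‖y - x‖ ^ 2 + r ^ 2)

section

variable {x y : Plane} {r : ℝ}

theorem hasFDerivAt_norm_sub_sq_add (x : Plane) (r : ℝ) (y : Plane) :
    HasFDerivAt (fun y => ‖y - x‖ ^ 2 + r ^ 2) (2 • innerSL ℝ (y - x)) y := by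
  have := (((hasFDerivAt_id y).sub_const x).norm_sq).add_const (r ^ 2)
  simpa using this

theorem hasFDerivAt_regKernel (h : 0 < ‖y - x‖ ^ 2 + r ^ 2) :
    HasFDerivAt (regKernel x r)
      ((-(1 / (2 * Real.pi)) * (‖y - x‖ ^ 2 + r ^ 2)⁻¹) • innerSL ℝ (y - x)) y := by
  refine (((hasFDerivAt_norm_sub_sq_add x r y).log h.ne').const_mul
    (-(1 / (4 * Real.pi)))).congr_fderiv ?_
  rw [← Nat.cast_smul_eq_nsmul ℝ, smul_smul, smul_smul]
  congr 1
  field_simp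
  norm_num

theorem contDiff_regKernel (x : Plane) (hr : 0 < r) : ContDiff ℝ 2 (regKernel x r) := by
  refine contDiff_const.mul (ContDiff.log ?_ fun y => by positivity)
  exact ((contDiff_id.sub contDiff_const).norm_sq ℝ).add contDiff_const

theorem fderiv_regKernel_apply (h : 0 < ‖y - x‖ ^ 2 + r ^ 2) (v : Plane) :
    fderiv ℝ (regKernel x r) y v =
      -(1 / (2 * Real.pi)) * (inner ℝ (y - x) v / (‖y - x‖ ^ 2 + r ^ 2)) := by
  rw [(hasFDerivAt_regKernel h).fderiv]
  rw [_root_.smul_apply, innerSL_apply_apply, smul_eq_mul, div_eq_mul_inv]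
  ring

theorem laplacian_regKernel (x : Plane) (hr : 0 < r) (y : Plane) :
    Laplacian.laplacian (regKernel x r) y =
      -(1 / Real.pi) * (r ^ 2 / (‖y - x‖ ^ 2 + r ^ 2) ^ 2) := by
  have hq : ∀ y : Plane, 0 < ‖y - x‖ ^ 2 + r ^ 2 := fun y => by positivity
  have hfun : fderiv ℝ (regKernel x r) = fun y =>
      (-(1 / (2 * Real.pi)) * (‖y - x‖ ^ 2 + r ^ 2)⁻¹) • innerSL ℝ (y - x) :=
    funext fun y => (hasFDerivAt_regKernel (hq y)).fderiv
  have h1 : HasFDerivAt (fun y => (‖y - x‖ ^ 2 + r ^ 2)⁻¹) _ y :=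
    (hasDerivAt_inv (hq y).ne').comp_hasFDerivAt y (hasFDerivAt_norm_sub_sq_add x r y)
  have h2 : HasFDerivAt (fun y => innerSL ℝ (y - x)) (innerSL ℝ : Plane →L[ℝ] Plane →L[ℝ] ℝ) y := by
    exact (innerSL ℝ : Plane →L[ℝ] Plane →L[ℝ] ℝ).hasFDerivAt.comp y
      ((hasFDerivAt_id y).sub_const x)
  have h3 := (h1.const_mul (-(1 / (2 * Real.pi)))).smul h2
  rw [laplacian_eq_divergence, divergence, hfun]
  have h4 : HasFDerivAt (fun y => (-(1 / (2 * Real.pi)) * (‖y - x‖ ^ 2 + r ^ 2)⁻¹) •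
    innerSL ℝ (y - x)) _ y := h3
  rw [h4.fderiv]
  have hn := norm_sq_eq_coords (y - x)
  have hqy := (hq y).ne'
  rw [hn] at hqy ⊢
  have hin (v w : Plane) : (innerSL ℝ : Plane →L[ℝ] Plane →L[ℝ] ℝ) v w = v 0 * w 0 + v 1 * w 1 :=
    inner_eq_coords v w
  simp [Fin.sum_univ_two, e, hin] at hqy ⊢
  field_simp
  ring

end

theorem fundamentalSolution_sub_eq (x : Plane) :
    (fun y => fundamentalSolution (x - y)) = regKernel x 0 := by
  funext y
  rw [fundamentalSolution, regKernel, norm_sub_rev x y, one_div ‖y - x‖, Real.log_inv]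
  simp only [ne_eq, OfNat.ofNat_ne_zero, not_false_eq_true, zero_pow, add_zero, Real.log_pow]
  push_cast
  field_simp
  ring

/-- A bound for the regularized kernels that is uniform in the regularization parameter. -/
theorem abs_regKernel_le {x y : Plane} {r : ℝ} (hy : y ≠ x) (hr0 : 0 ≤ r) (hr : r ≤ 1) :
    |regKernel x r y| ≤ 2 * |Real.log ‖y - x‖| + (‖y - x‖ ^ 2 + 1) := by
  have hρ : 0 < ‖y - x‖ := norm_pos_iff.2 (sub_ne_zero.2 hy)
  set ρ := ‖y - x‖
  have hpi : |-(1 / (4 * Real.pi))| ≤ 1 := by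
    rw [abs_neg, abs_of_pos (by positivity), div_le_one (by positivity)]
    linarith [Real.pi_gt_three]
  rw [regKernel, abs_mul]
  refine (mul_le_of_le_one_left (abs_nonneg _) hpi).trans ?_
  have hr2 : r ^ 2 ≤ 1 := by nlinarith
  have hlow : 2 * Real.log ρ ≤ Real.log (ρ ^ 2 + r ^ 2) := by
    have : Real.log (ρ ^ 2) = 2 * Real.log ρ := by simp
    rw [← this]
    exact Real.log_le_log (by positivity) (by nlinarith)
  have hup : Real.log (ρ ^ 2 + r ^ 2) ≤ ρ ^ 2 + 1 :=
    (Real.log_le_self (by positivity)).trans (by linarith)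
  rw [abs_le]
  constructor
  · nlinarith [neg_abs_le (Real.log ρ)]
  · linarith [abs_nonneg (Real.log ρ)]

theorem tendsto_regKernel {x y : Plane} (hy : y ≠ x) :
    Tendsto (fun r => regKernel x r y) (𝓝[>] 0) (𝓝 (regKernel x 0 y)) := by
  have hρ : 0 < ‖y - x‖ := norm_pos_iff.2 (sub_ne_zero.2 hy)
  have h0 : ‖y - x‖ ^ 2 + (0 : ℝ) ^ 2 ≠ 0 := by positivity
  have : ContinuousAt (fun r : ℝ => regKernel x r y) 0 :=
    ContinuousAt.mul continuousAt_const
      (ContinuousAt.log (f := fun r : ℝ => ‖y - x‖ ^ 2 + r ^ 2) (by fun_prop) h0)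
  exact this.tendsto.mono_left nhdsWithin_le_nhds

theorem tendsto_fderiv_regKernel {x y : Plane} (hy : y ≠ x) (v : Plane) :
    Tendsto (fun r => fderiv ℝ (regKernel x r) y v) (𝓝[>] 0)
      (𝓝 (fderiv ℝ (regKernel x 0) y v)) := by
  have hρ : 0 < ‖y - x‖ := norm_pos_iff.2 (sub_ne_zero.2 hy)
  have hq (r : ℝ) : 0 < ‖y - x‖ ^ 2 + r ^ 2 := by positivity
  simp only [fderiv_regKernel_apply (hq _)]
  have : Continuous fun r : ℝ =>
      -(1 / (2 * Real.pi)) * (inner ℝ (y - x) v / (‖y - x‖ ^ 2 + r ^ 2)) :=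
    continuous_const.mul (continuous_const.div (by fun_prop) fun r => (hq r).ne')
  exact (this.tendsto 0).mono_left nhdsWithin_le_nhds

theorem integrableOn_log_norm_sub (x : Plane) {s : Set Plane} (hs : Bornology.IsBounded s) :
    IntegrableOn (fun y => Real.log ‖y - x‖) s := by
  obtain ⟨R, hR⟩ := hs.subset_ball x
  refine IntegrableOn.mono_set ?_ hR
  have h0 : IntegrableOn (fun y : Plane => Real.log ‖y‖) (Metric.ball 0 R) := by
    rw [integrableOn_fun_norm_addHaar]
    refine IntegrableOn.mono_set ?_ Ioo_subset_Icc_self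
    have : Continuous fun y : ℝ => y ^ (Module.finrank ℝ Plane - 1) • Real.log y := by
      simpa using Real.continuous_mul_log
    exact this.integrableOn_Icc
  have h1 := ((measurePreserving_sub_right (volume : Measure Plane) x).integrableOn_comp_preimage
    (MeasurableEquiv.subRight x).measurableEmbedding).2 h0
  have hpre : (fun y : Plane => y - x) ⁻¹' Metric.ball 0 R = Metric.ball x R := by
    ext y; simp [dist_eq_norm]
  rw [hpre] at h1
  exact h1

/-! ### Concentration of the regularized Laplacian at a boundary point -/

/-- The profile of the Laplacian of the regularized fundamental solution. -/
def profile (z : Plane) : ℝ := ((1 + ‖z‖ ^ 2) ^ 2)⁻¹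

theorem continuous_profile : Continuous profile := by
  refine Continuous.inv₀ (by fun_prop) fun z => ?_
  positivity

theorem hasDerivAt_profile_primitive (y : ℝ) :
    HasDerivAt (fun y : ℝ => -(2 * (1 + y ^ 2))⁻¹) (y * ((1 + y ^ 2) ^ 2)⁻¹) y := by
  have hq : 2 * (1 + y ^ 2) ≠ 0 := by positivity
  have h := ((((hasDerivAt_pow 2 y).const_add 1).const_mul 2).inv hq).neg
  refine h.congr_deriv ?_
  have : 1 + y ^ 2 ≠ 0 := by positivity
  field_simp
  norm_num

theorem tendsto_profile_primitive :
    Tendsto (fun y : ℝ => -(2 * (1 + y ^ 2))⁻¹) atTop (𝓝 0) := by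
  have h : Tendsto (fun y : ℝ => 2 * (1 + y ^ 2)) atTop atTop :=
    (tendsto_atTop_add_const_left _ _ (tendsto_pow_atTop two_ne_zero)).const_mul_atTop two_pos
  simpa using h.inv_tendsto_atTop.neg

theorem integrable_profile : Integrable profile := by
  have := (integrable_fun_norm_addHaar (volume : Measure Plane)
    (f := fun y : ℝ => ((1 + y ^ 2) ^ 2)⁻¹)).2 (by
      have := integrableOn_Ioi_deriv_of_nonneg' (a := (0 : ℝ))
        (fun y _ => hasDerivAt_profile_primitive y)
        (fun y hy => mul_nonneg (le_of_lt hy) (by positivity)) tendsto_profile_primitive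
      simpa using this)
  exact this

theorem integral_profile : ∫ z, profile z = Real.pi := by
  have h1 := integral_fun_norm_addHaar (volume : Measure Plane)
    (fun y : ℝ => ((1 + y ^ 2) ^ 2)⁻¹)
  have h2 := integral_Ioi_of_hasDerivAt_of_nonneg' (a := (0 : ℝ))
    (fun y _ => hasDerivAt_profile_primitive y)
    (fun y hy => mul_nonneg (le_of_lt hy) (by positivity)) tendsto_profile_primitive
  have h3 : (volume : Measure Plane).real (Metric.ball 0 1) = Real.pi := by
    simp [Measure.real, EuclideanSpace.volume_ball_fin_two, Real.pi_pos.le]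
  refine h1.trans ?_
  rw [h3]
  simp only [finrank_euclideanSpace_fin, Nat.add_one_sub_one, pow_one, smul_eq_mul, h2]
  norm_num
  ring

theorem ae_apply_ne_zero {l : Plane →L[ℝ] ℝ} (hl : l ≠ 0) : ∀ᵐ z : Plane, l z ≠ 0 := by
  have hnull : (volume : Measure Plane) {z | l z = 0} = 0 := by
    refine Measure.addHaar_submodule volume (LinearMap.ker (l : Plane →ₗ[ℝ] ℝ)) ?_
    intro h
    apply hl
    ext z
    have : z ∈ LinearMap.ker (l : Plane →ₗ[ℝ] ℝ) := h ▸ Submodule.mem_top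
    simpa using this
  rw [ae_iff]
  simpa using hnull

/-- A half plane through the origin carries half of the mass of the profile. -/
theorem integral_profile_halfPlane {l : Plane →L[ℝ] ℝ} (hl : l ≠ 0) :
    ∫ z, {z | 0 < l z}.indicator profile z = Real.pi / 2 := by
  have hm (c : ℝ) : MeasurableSet {z : Plane | 0 < c * l z} :=
    (isOpen_lt continuous_const (continuous_const.mul l.continuous)).measurableSet
  have hp : MeasurableSet {z : Plane | 0 < l z} := by simpa using hm 1
  have hn : MeasurableSet {z : Plane | 0 < -l z} := by simpa using hm (-1)
  have hsymm : ∫ z, {z | 0 < -l z}.indicator profile z =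
      ∫ z, {z | 0 < l z}.indicator profile z := by
    rw [← integral_neg_eq_self]
    refine integral_congr_ae (Eventually.of_forall fun z => ?_)
    simp [indicator, profile]
  have hsum : ∫ z, profile z = (∫ z, {z | 0 < l z}.indicator profile z) +
      ∫ z, {z | 0 < -l z}.indicator profile z := by
    rw [← integral_add (integrable_profile.indicator hp) (integrable_profile.indicator hn)]
    refine integral_congr_ae ?_
    filter_upwards [ae_apply_ne_zero hl] with z hz
    rcases lt_or_gt_of_ne hz with h | h
    · simp [indicator, h, not_lt.2 h.le]
    · simp [indicator, h, not_lt.2 h.le]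
  rw [integral_profile, hsymm] at hsum
  linarith

/-- The Laplacian of the regularized fundamental solution, integrated in rescaled coordinates. -/
theorem integral_mul_laplacian_regKernel (x : Plane) {r : ℝ} (hr : 0 < r) (f : Plane → ℝ) :
    ∫ y, f y * Laplacian.laplacian (regKernel x r) y =
      -(1 / Real.pi) * ∫ z, f (x + r • z) * profile z := by
  have h1 := Measure.integral_comp_smul (volume : Measure Plane)
    (fun y => f (x + y) * Laplacian.laplacian (regKernel x r) (x + y)) r
  have h2 := integral_add_left_eq_self (μ := (volume : Measure Plane))
    (fun y => f y * Laplacian.laplacian (regKernel x r) y) x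
  rw [h2] at h1
  rw [finrank_euclideanSpace_fin, abs_of_pos (by positivity), smul_eq_mul] at h1
  have h3 : ∫ y, f y * Laplacian.laplacian (regKernel x r) y =
      r ^ 2 * ∫ z, f (x + r • z) * Laplacian.laplacian (regKernel x r) (x + r • z) := by
    rw [h1]; field_simp
  rw [h3, ← integral_const_mul, ← integral_const_mul]
  refine integral_congr_ae (Eventually.of_forall fun z => ?_)
  simp only [laplacian_regKernel x hr, profile, add_sub_cancel_left, norm_smul, Real.norm_eq_abs,
    mul_pow, sq_abs]
  field_simp
  ring

namespace IsInnerTube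

variable {γ : ℝ → Plane} {σ δ : ℝ} {u : Plane → ℝ}

/-- Near a boundary point, the interior of the curve looks like a half plane. -/
theorem exists_halfPlane (h : IsInnerTube σ γ δ) (hγ : IsRegularSimpleClosedCurve γ) (t : ℝ) :
    ∃ l : Plane →L[ℝ] ℝ, l ≠ 0 ∧
      (∀ z, 0 < l z → ∀ᶠ r in 𝓝[>] (0 : ℝ), γ t + r • z ∈ curveInterior γ) ∧
      (∀ z, l z < 0 → ∀ᶠ r in 𝓝[>] (0 : ℝ), γ t + r • z ∉ curveInterior γ) := by
  have hp : |(!₂[t, 0] : Plane) 1| < δ := by simpa using h.pos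
  have hcd := (h.contDiffAt_tubeCoord hγ hp).differentiableAt one_ne_zero
  have hc0 := h.tubeCoord_tubeMap hp
  have hU := (h.isOpen_tube hγ).mem_nhds ⟨_, hp, rfl⟩
  have hval := h.fderiv_tubeCoord_tubeDeriv hγ hp (e 1)
  rw [tubeMap_mk_zero] at hcd hc0 hU hval
  refine ⟨fderiv ℝ (tubeCoord σ γ δ) (γ t), ?_, ?_, ?_⟩
  · intro h0
    simp [h0, e] at hval
  all_goals
    intro z hz
    have hline : HasDerivAt (fun r : ℝ => γ t + r • z) z 0 := by
      simpa using ((hasDerivAt_id (0 : ℝ)).smul_const z).const_add (γ t)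
    have hd : HasDerivAt (fun r : ℝ => tubeCoord σ γ δ (γ t + r • z))
        (fderiv ℝ (tubeCoord σ γ δ) (γ t) z) 0 := by
      refine HasFDerivAt.comp_hasDerivAt (l := tubeCoord σ γ δ) (f := fun r : ℝ => γ t + r • z)
        0 ?_ hline
      simpa using hcd.hasFDerivAt
    have hslope := hasDerivAt_iff_tendsto_slope.1 hd
    have hmem : ∀ᶠ r in 𝓝[>] (0 : ℝ), γ t + r • z ∈ tube σ γ δ := by
      have : Tendsto (fun r : ℝ => γ t + r • z) (𝓝 0) (𝓝 (γ t)) := by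
        simpa using hline.continuousAt.tendsto
      exact (this.mono_left nhdsWithin_le_nhds).eventually hU
    have hmono : 𝓝[>] (0 : ℝ) ≤ 𝓝[≠] 0 := nhdsWithin_mono _ fun r hr => ne_of_gt hr
  · filter_upwards [hmem, self_mem_nhdsWithin,
      (hslope.mono_left hmono).eventually (lt_mem_nhds hz)] with r hr hr0 hs
    obtain ⟨p, hp, hpr⟩ := hr
    simp only [slope_def_field, zero_smul, add_zero, hc0, sub_zero, ← hpr,
      h.tubeCoord_tubeMap hp] at hs
    rw [← hpr]
    refine h.mem_interior p ?_ (abs_lt.1 hp).2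
    have := (div_pos_iff_of_pos_right (show (0 : ℝ) < r from hr0)).1 (by simpa using hs)
    exact this
  · filter_upwards [hmem, self_mem_nhdsWithin,
      (hslope.mono_left hmono).eventually (gt_mem_nhds hz)] with r hr hr0 hs
    obtain ⟨p, hp, hpr⟩ := hr
    simp only [slope_def_field, zero_smul, add_zero, hc0, sub_zero, ← hpr,
      h.tubeCoord_tubeMap hp] at hs
    rw [← hpr]
    refine h.notMem_interior p (abs_lt.1 hp).1 ?_
    by_contra h0
    have h1 : 0 < p 1 / r := div_pos (not_le.1 h0) hr0
    have h2 : p 1 / r < 0 := by simpa using hs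
    exact lt_asymm h1 h2

/-- At a boundary point, only half of the mass of the regularized point source lies in the
interior; this is where the jump term comes from. -/
theorem tendsto_integral_mul_laplacian_regKernel (h : IsInnerTube σ γ δ)
    (hγ : IsRegularSimpleClosedCurve γ) (hu : ContinuousOn u (closure (curveInterior γ))) (t : ℝ) :
    Tendsto (fun r => ∫ y in curveInterior γ, u y * Laplacian.laplacian (regKernel (γ t) r) y)
      (𝓝[>] 0) (𝓝 (-(1 / 2 * u (γ t)))) := by
  have hΩ := hγ.isOpen_curveInterior
  obtain ⟨l, hl, hpos, hneg⟩ := h.exists_halfPlane hγ t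
  obtain ⟨M, hM⟩ := (isCompact_closure hγ).exists_bound_of_continuousOn hu
  have hM0 : 0 ≤ M := (norm_nonneg _).trans (hM (γ t) (h.range_subset_closure ⟨t, rfl⟩))
  set F := (curveInterior γ).indicator u with hF
  have hFb (y : Plane) : ‖F y‖ ≤ M := by
    by_cases hy : y ∈ curveInterior γ
    · rw [hF, indicator_of_mem hy]; exact hM y (subset_closure hy)
    · rw [hF, indicator_of_notMem hy, norm_zero]; exact hM0
  have hFm : Measurable F := by
    classical
    rw [hF, ← piecewise_eq_indicator]
    exact (hu.mono subset_closure).measurable_piecewise continuousOn_const hΩ.measurableSet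
  have hlim : Tendsto (fun r : ℝ => ∫ z, F (γ t + r • z) * profile z) (𝓝[>] 0)
      (𝓝 (∫ z, u (γ t) * {z | 0 < l z}.indicator profile z)) := by
    refine tendsto_integral_filter_of_dominated_convergence (fun z => M * profile z) ?_ ?_
      (integrable_profile.const_mul M) ?_
    · refine Eventually.of_forall fun r => ?_
      exact ((hFm.comp (by fun_prop)).mul continuous_profile.measurable).aestronglyMeasurable
    · refine Eventually.of_forall fun r => Eventually.of_forall fun z => ?_
      have hp : 0 ≤ profile z := by unfold profile; positivity
      rw [norm_mul, Real.norm_of_nonneg hp]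
      exact mul_le_mul_of_nonneg_right (hFb _) hp
    · filter_upwards [ae_apply_ne_zero hl] with z hz
      rcases lt_or_gt_of_ne hz with hz | hz
      · have : {z | 0 < l z}.indicator profile z = 0 := by
          simp [indicator, not_lt.2 hz.le]
        rw [this, mul_zero]
        refine tendsto_const_nhds.congr' ?_
        filter_upwards [hneg z hz] with r hr
        rw [hF, indicator_of_notMem hr, zero_mul]
      · have : {z | 0 < l z}.indicator profile z = profile z := by
          simp [indicator, hz]
        rw [this]
        refine Tendsto.mul_const _ ?_
        have h1 : Tendsto (fun r : ℝ => γ t + r • z) (𝓝[>] 0)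
            (𝓝[closure (curveInterior γ)] (γ t)) := by
          refine tendsto_nhdsWithin_iff.2 ⟨?_, (hpos z hz).mono fun r hr => subset_closure hr⟩
          have : Continuous fun r : ℝ => γ t + r • z := by fun_prop
          simpa using (this.tendsto 0).mono_left (nhdsWithin_le_nhds (s := Ioi 0))
        refine ((hu (γ t) (h.range_subset_closure ⟨t, rfl⟩)).tendsto.comp h1).congr' ?_
        filter_upwards [hpos z hz] with r hr
        rw [hF, indicator_of_mem hr]; rfl
  rw [integral_const_mul, integral_profile_halfPlane hl] at hlim
  have hlim' := hlim.const_mul (-(1 / Real.pi))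
  have hval : -(1 / Real.pi) * (u (γ t) * (Real.pi / 2)) = -(1 / 2 * u (γ t)) := by
    field_simp
  rw [hval] at hlim'
  refine hlim'.congr' ?_
  filter_upwards [self_mem_nhdsWithin] with r hr
  rw [← integral_mul_laplacian_regKernel (γ t) hr, ← integral_indicator hΩ.measurableSet]
  refine integral_congr_ae (Eventually.of_forall fun y => ?_)
  by_cases hy : y ∈ curveInterior γ <;> simp [hF, hy]

end IsInnerTube

theorem measurable_regKernel (x : Plane) (r : ℝ) : Measurable (regKernel x r) :=
  (Real.measurable_log.comp (by fun_prop : Continuous fun y : Plane =>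
    ‖y - x‖ ^ 2 + r ^ 2).measurable).const_mul _

/-! ### The limit of the domain integral -/

namespace IsRegularSimpleClosedCurve

variable {γ : ℝ → Plane} {σ : ℝ} {g : Plane → ℝ}

/-- The regularized potentials of a bounded density converge to its logarithmic potential. -/
theorem tendsto_integral_regKernel_mul (hγ : IsRegularSimpleClosedCurve γ) {x : Plane}
    (hx : x ∉ curveInterior γ)
    (hg : AEStronglyMeasurable g (volume.restrict (curveInterior γ)))
    (hb : ∃ M : ℝ, ∀ y ∈ curveInterior γ, |g y| ≤ M) :
    IntegrableOn (fun y => regKernel x 0 y * g y) (curveInterior γ) ∧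
    Tendsto (fun r => ∫ y in curveInterior γ, regKernel x r y * g y) (𝓝[>] 0)
      (𝓝 (∫ y in curveInterior γ, regKernel x 0 y * g y)) := by
  obtain ⟨M, hM⟩ := hb
  have hΩ := hγ.isOpen_curveInterior
  have hne : ∀ y ∈ curveInterior γ, y ≠ x := fun y hy hyx => hx (hyx ▸ hy)
  have hG : IntegrableOn (fun y => (2 * |Real.log ‖y - x‖| + (‖y - x‖ ^ 2 + 1)) * M)
      (curveInterior γ) := by
    refine Integrable.mul_const (Integrable.add ?_ ?_) M
    · exact (integrableOn_log_norm_sub x hγ.isBounded_curveInterior).abs.const_mul 2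
    · have hc : Continuous fun y : Plane => ‖y - x‖ ^ 2 + 1 := by fun_prop
      exact (hc.continuousOn.integrableOn_compact
        hγ.isBounded_curveInterior.isCompact_closure).mono_set subset_closure
  have hbound {r : ℝ} (hr0 : 0 ≤ r) (hr : r ≤ 1) : ∀ᵐ y ∂volume.restrict (curveInterior γ),
      ‖regKernel x r y * g y‖ ≤ (2 * |Real.log ‖y - x‖| + (‖y - x‖ ^ 2 + 1)) * M := by
    filter_upwards [ae_restrict_mem hΩ.measurableSet] with y hy
    rw [norm_mul]
    exact mul_le_mul (abs_regKernel_le (hne y hy) hr0 hr) (hM y hy) (norm_nonneg _) (by positivity)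
  have hmeas (r : ℝ) : AEStronglyMeasurable (fun y => regKernel x r y * g y)
      (volume.restrict (curveInterior γ)) :=
    (measurable_regKernel x r).aestronglyMeasurable.mul hg
  refine ⟨Integrable.mono' hG (hmeas 0) (hbound le_rfl zero_le_one),
    tendsto_integral_filter_of_dominated_convergence _ (Eventually.of_forall hmeas) ?_ hG ?_⟩
  · filter_upwards [Ioo_mem_nhdsGT (zero_lt_one (α := ℝ))] with r hr
    exact hbound hr.1.le hr.2.le
  · filter_upwards [ae_restrict_mem hΩ.measurableSet] with y hy
    exact (tendsto_regKernel (hne y hy)).mul_const _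

/-! ### The limit of the boundary integral -/

theorem eq_of_abs_sub_le (hγ : IsRegularSimpleClosedCurve γ) {s t : ℝ} (h : |t - s| ≤ 1 / 2)
    (hst : γ t = γ s) : t = s := by
  obtain ⟨k, hk⟩ := hγ.exists_int_of_eq hst
  have h1 : |(k : ℝ)| ≤ 1 / 2 := by rwa [hk, add_sub_cancel_left] at h
  have h2 : |k| < 1 := by
    have : (|k| : ℝ) < 1 := by linarith
    exact_mod_cast this
  rw [hk, Int.abs_lt_one_iff.1 h2]
  simp

/-- The curve is bi-Lipschitz from below on a period centred at `t₀`. -/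
theorem exists_mul_abs_le_norm_sub (hγ : IsRegularSimpleClosedCurve γ) (t₀ : ℝ) :
    ∃ c > 0, ∀ t, |t - t₀| ≤ 1 / 2 → c * |t - t₀| ≤ ‖γ t - γ t₀‖ := by
  have hcont : ContinuousOn (dslope γ t₀) univ :=
    (continuousOn_dslope univ_mem).2 ⟨hγ.continuous.continuousOn,
      (hγ.hasDerivAt t₀).differentiableAt⟩
  obtain ⟨s, hs, hmin⟩ := (isCompact_closedBall t₀ (1 / 2)).exists_isMinOn ⟨t₀, by simp⟩
    (hcont.norm.mono (subset_univ _))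
  have hs' : |s - t₀| ≤ 1 / 2 := by simpa [Real.dist_eq] using hs
  refine ⟨‖dslope γ t₀ s‖, norm_pos_iff.2 ?_, fun t ht => ?_⟩
  · by_cases hst : s = t₀
    · rw [hst, dslope_same]; exact hγ.regular t₀
    · rw [dslope_of_ne _ hst, slope_def_module]
      refine smul_ne_zero (inv_ne_zero (sub_ne_zero.2 hst)) (sub_ne_zero.2 fun h => hst ?_)
      exact hγ.eq_of_abs_sub_le hs' h
  · have h1 : ‖dslope γ t₀ s‖ ≤ ‖dslope γ t₀ t‖ := hmin (by simpa [Real.dist_eq] using ht)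
    have h2 : (t - t₀) • dslope γ t₀ t = γ t - γ t₀ := sub_smul_dslope γ t₀ t
    rw [← h2, norm_smul, Real.norm_eq_abs, mul_comm]
    gcongr

/-- The kernel of the double layer potential of a curve of class `C²` is bounded: the chord
deviates from the tangent only to second order. -/
theorem exists_abs_inner_normalField_le (hγ : IsRegularSimpleClosedCurve γ) (t₀ : ℝ) :
    ∃ C, ∀ t, |t - t₀| ≤ 1 / 2 →
      |inner ℝ (γ t - γ t₀) (normalField σ γ t)| ≤ C * ‖γ t - γ t₀‖ ^ 2 := by
  obtain ⟨c, hc, hlow⟩ := hγ.exists_mul_abs_le_norm_sub t₀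
  obtain ⟨M₁, hM₁0, hM₁⟩ := exists_norm_le_of_periodic (hγ.continuous_normalField (σ := σ))
    hγ.periodic_normalField
  obtain ⟨M₂, hM₂0, hM₂⟩ := exists_norm_le_of_periodic (hγ.contDiff_deriv.continuous_deriv le_rfl)
    (periodic_deriv (periodic_deriv hγ.periodic))
  have hlip (s t : ℝ) : ‖deriv γ s - deriv γ t‖ ≤ M₂ * |s - t| :=
    convex_univ.norm_image_sub_le_of_norm_deriv_le
      (fun x _ => hγ.contDiff_deriv.differentiable (by norm_num) x) (fun x _ => hM₂ x)
      (mem_univ t) (mem_univ s)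
  refine ⟨M₂ / c ^ 2 * M₁, fun t ht => ?_⟩
  have hT : ‖γ t - γ t₀ - (t - t₀) • deriv γ t‖ ≤ M₂ * |t - t₀| * |t - t₀| := by
    have hd : ∀ s ∈ uIcc t₀ t, HasDerivWithinAt (fun s => γ s - s • deriv γ t)
        (deriv γ s - (1 : ℝ) • deriv γ t) (uIcc t₀ t) s := fun s _ =>
      ((hγ.hasDerivAt s).sub ((hasDerivAt_id s).smul_const _)).hasDerivWithinAt
    have := (convex_uIcc t₀ t).norm_image_sub_le_of_norm_hasDerivWithin_le hd
      (C := M₂ * |t - t₀|) (fun s hs => by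
        rw [one_smul]
        refine (hlip s t).trans (mul_le_mul_of_nonneg_left ?_ hM₂0)
        rw [abs_sub_comm s t]
        exact abs_sub_right_of_mem_uIcc hs) left_mem_uIcc right_mem_uIcc
    refine le_trans (le_of_eq ?_) this
    congr 1
    module
  have horth : inner ℝ (deriv γ t) (normalField σ γ t) = 0 := by
    rw [inner_eq_coords]; simp [normalField]; ring
  have hin : inner ℝ (γ t - γ t₀) (normalField σ γ t) =
      inner ℝ (γ t - γ t₀ - (t - t₀) • deriv γ t) (normalField σ γ t) := by
    rw [inner_sub_left (γ t - γ t₀), inner_smul_left, horth]; simp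
  rw [hin]
  have h1 : (c * |t - t₀|) ^ 2 ≤ ‖γ t - γ t₀‖ ^ 2 := by
    have := hlow t ht
    gcongr
  calc _ ≤ ‖γ t - γ t₀ - (t - t₀) • deriv γ t‖ * ‖normalField σ γ t‖ := abs_real_inner_le_norm _ _
    _ ≤ M₂ * |t - t₀| * |t - t₀| * M₁ := by gcongr; exact hM₁ t
    _ = M₂ / c ^ 2 * M₁ * (c * |t - t₀|) ^ 2 := by field_simp
    _ ≤ _ := by gcongr

/-- The boundary integrals with the regularized kernels converge to the boundary integral with the
fundamental solution, which converges absolutely. -/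
theorem tendsto_boundary_integral (hγ : IsRegularSimpleClosedCurve γ) (t₀ : ℝ) {p q : ℝ → ℝ}
    (hp : Continuous p) (hq : Continuous q) (hp1 : Function.Periodic p 1)
    (hq1 : Function.Periodic q 1) :
    IntervalIntegrable (fun t => regKernel (γ t₀) 0 (γ t) * p t -
        q t * fderiv ℝ (regKernel (γ t₀) 0) (γ t) (normalField σ γ t)) volume 0 1 ∧
    Tendsto (fun r => ∫ t in (0 : ℝ)..1, (regKernel (γ t₀) r (γ t) * p t -
        q t * fderiv ℝ (regKernel (γ t₀) r) (γ t) (normalField σ γ t))) (𝓝[>] 0)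
      (𝓝 (∫ t in (0 : ℝ)..1, (regKernel (γ t₀) 0 (γ t) * p t -
        q t * fderiv ℝ (regKernel (γ t₀) 0) (γ t) (normalField σ γ t)))) := by
  set b : ℝ → ℝ → ℝ := fun r t => regKernel (γ t₀) r (γ t) * p t -
        q t * fderiv ℝ (regKernel (γ t₀) r) (γ t) (normalField σ γ t) with hb
  have hper (r : ℝ) : Function.Periodic (b r) 1 := fun t => by
    simp only [hb, hγ.periodic t, hp1 t, hq1 t, hγ.periodic_normalField (σ := σ) t]
  obtain ⟨P, hP0, hP⟩ := exists_norm_le_of_periodic hp hp1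
  obtain ⟨Q, hQ0, hQ⟩ := exists_norm_le_of_periodic hq hq1
  obtain ⟨R, hR0, hR⟩ := exists_norm_le_of_periodic (hγ.continuous.sub continuous_const)
    (f := fun t => γ t - γ t₀) (fun t => by simp [hγ.periodic t])
  obtain ⟨c, hc, hlow⟩ := hγ.exists_mul_abs_le_norm_sub t₀
  obtain ⟨C, hC⟩ := hγ.exists_abs_inner_normalField_le (σ := σ) t₀
  let G : ℝ → ℝ := fun t =>
    (2 * (|Real.log c| + |Real.log (t - t₀)| + R) + (R ^ 2 + 1)) * P + Q * C
  have hGint : IntervalIntegrable G volume (t₀ - 1 / 2) (t₀ + 1 / 2) := by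
    have hl : IntervalIntegrable (fun t => Real.log (t - t₀)) volume (t₀ - 1 / 2) (t₀ + 1 / 2) := by
      have := (intervalIntegral.intervalIntegrable_log' (a := -(1 / 2))
        (b := 1 / 2)).comp_sub_right t₀
      rwa [neg_add_eq_sub, add_comm (1 / 2 : ℝ)] at this
    exact ((((intervalIntegrable_const.add hl.abs).add intervalIntegrable_const).const_mul 2).add
      intervalIntegrable_const).mul_const P |>.add intervalIntegrable_const
  have hne {t : ℝ} (ht : |t - t₀| ≤ 1 / 2) (h0 : t ≠ t₀) : γ t ≠ γ t₀ :=
    fun h => h0 (hγ.eq_of_abs_sub_le ht h)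
  have hbound {r t : ℝ} (hr0 : 0 ≤ r) (hr : r ≤ 1) (ht : |t - t₀| ≤ 1 / 2) (h0 : t ≠ t₀) :
      ‖b r t‖ ≤ G t := by
    have hρ : 0 < ‖γ t - γ t₀‖ := norm_pos_iff.2 (sub_ne_zero.2 (hne ht h0))
    have hRt : ‖γ t - γ t₀‖ ≤ R := hR t
    have hCt := hC t ht
    have hlog : |Real.log ‖γ t - γ t₀‖| ≤ |Real.log c| + |Real.log (t - t₀)| + R := by
      have h1 : Real.log (c * |t - t₀|) ≤ Real.log ‖γ t - γ t₀‖ :=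
        Real.log_le_log (mul_pos hc (abs_pos.2 (sub_ne_zero.2 h0))) (hlow t ht)
      rw [Real.log_mul hc.ne' (abs_pos.2 (sub_ne_zero.2 h0)).ne', Real.log_abs] at h1
      have h2 := Real.log_le_self hρ.le
      rw [abs_le]
      constructor
      · linarith [neg_abs_le (Real.log c), neg_abs_le (Real.log (t - t₀))]
      · linarith [abs_nonneg (Real.log c), abs_nonneg (Real.log (t - t₀))]
    have hk := abs_regKernel_le (hne ht h0) hr0 hr
    have hk' : |regKernel (γ t₀) r (γ t)| ≤
        2 * (|Real.log c| + |Real.log (t - t₀)| + R) + (R ^ 2 + 1) := by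
      refine hk.trans ?_
      gcongr
    have hq' : 0 < ‖γ t - γ t₀‖ ^ 2 + r ^ 2 := by positivity
    have hC0 : 0 ≤ C := by
      by_contra hC0
      have : C * ‖γ t - γ t₀‖ ^ 2 < 0 := mul_neg_of_neg_of_pos (not_le.1 hC0) (by positivity)
      linarith [abs_nonneg (inner ℝ (γ t - γ t₀) (normalField σ γ t))]
    have hd : |fderiv ℝ (regKernel (γ t₀) r) (γ t) (normalField σ γ t)| ≤ C := by
      rw [fderiv_regKernel_apply hq', abs_mul, abs_div, abs_of_pos hq']
      have hpi : |-(1 / (2 * Real.pi))| ≤ 1 := by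
        rw [abs_neg, abs_of_pos (by positivity), div_le_one (by positivity)]
        linarith [Real.pi_gt_three]
      refine (mul_le_of_le_one_left (by positivity) hpi).trans ?_
      rw [div_le_iff₀ hq']
      exact hCt.trans (by gcongr; linarith [sq_nonneg r])
    refine (norm_sub_le _ _).trans ?_
    rw [norm_mul, norm_mul]
    have h1 := hP t
    have h2 := hQ t
    simp only [Real.norm_eq_abs] at *
    exact add_le_add (mul_le_mul hk' h1 (abs_nonneg _) (by positivity))
      (mul_le_mul h2 hd (abs_nonneg _) hQ0)
  have hae : ∀ᵐ t : ℝ, t ∈ uIoc (t₀ - 1 / 2) (t₀ + 1 / 2) → |t - t₀| ≤ 1 / 2 ∧ t ≠ t₀ := by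
    have : ∀ᵐ t : ℝ, t ≠ t₀ := by simp [ae_iff]
    filter_upwards [this] with t ht htI
    rw [uIoc_of_le (by linarith)] at htI
    exact ⟨abs_le.2 ⟨by linarith [htI.1], by linarith [htI.2]⟩, ht⟩
  have hcont {r : ℝ} (hr : 0 < r) : Continuous (b r) := by
    have h1 := contDiff_regKernel (γ t₀) hr
    have h2 := (h1.continuous_fderiv (by norm_num)).comp hγ.continuous
    exact ((h1.continuous.comp hγ.continuous).mul hp).sub
      (hq.mul (h2.clm_apply hγ.continuous_normalField))
  have hlim : ∀ᵐ t : ℝ, t ∈ uIoc (t₀ - 1 / 2) (t₀ + 1 / 2) →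
      Tendsto (fun r => b r t) (𝓝[>] 0) (𝓝 (b 0 t)) := by
    filter_upwards [hae] with t ht htI
    have hn := hne (ht htI).1 (ht htI).2
    exact ((tendsto_regKernel hn).mul_const _).sub
      ((tendsto_fderiv_regKernel hn _).const_mul _)
  have hshift (r : ℝ) : ∫ t in (t₀ - 1 / 2)..(t₀ + 1 / 2), b r t = ∫ t in (0 : ℝ)..1, b r t := by
    have := (hper r).intervalIntegral_add_eq (t₀ - 1 / 2) 0
    rwa [zero_add, show t₀ - 1 / 2 + 1 = t₀ + 1 / 2 by ring] at this
  have hmeas : AEStronglyMeasurable (b 0)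
      (volume.restrict (uIoc (t₀ - 1 / 2) (t₀ + 1 / 2))) := by
    have hr : Tendsto (fun n : ℕ => 1 / ((n : ℝ) + 1)) atTop (𝓝[>] 0) :=
      tendsto_nhdsWithin_iff.2 ⟨tendsto_one_div_add_atTop_nhds_zero_nat,
        Eventually.of_forall fun n => show (0 : ℝ) < _ by positivity⟩
    refine aestronglyMeasurable_of_tendsto_ae atTop
      (fun n : ℕ => (hcont (r := 1 / ((n : ℝ) + 1)) (by positivity)).aestronglyMeasurable) ?_
    filter_upwards [ae_restrict_mem measurableSet_uIoc, ae_restrict_of_ae hlim] with t ht htl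
    exact (htl ht).comp hr
  constructor
  · have h0 : IntervalIntegrable (b 0) volume (t₀ - 1 / 2) (t₀ + 1 / 2) := by
      refine hGint.mono_fun' hmeas ?_
      filter_upwards [ae_restrict_mem measurableSet_uIoc, ae_restrict_of_ae hae] with t ht hta
      exact hbound le_rfl zero_le_one (hta ht).1 (hta ht).2
    have := ((hper 0).intervalIntegrable_iff (t₁ := t₀ - 1 / 2) (t₂ := 0)).1 (by
      rwa [show t₀ - 1 / 2 + 1 = t₀ + 1 / 2 by ring])
    rwa [zero_add] at this
  · rw [← hshift 0]
    refine Tendsto.congr (fun r => hshift r) ?_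
    refine intervalIntegral.tendsto_integral_filter_of_dominated_convergence G ?_ ?_ hGint hlim
    · filter_upwards [self_mem_nhdsWithin] with r hr
      exact (hcont hr).aestronglyMeasurable
    · filter_upwards [Ioo_mem_nhdsGT (zero_lt_one (α := ℝ))] with r hr
      filter_upwards [hae] with t ht htI
      exact hbound hr.1.le hr.2.le (ht htI).1 (ht htI).2

end IsRegularSimpleClosedCurve

end PlanarPotential

end

theorem mainTheorem4 (γ : ℝ → PlanarPotential.Plane)
    (hγ : PlanarPotential.IsRegularSimpleClosedCurve γ)
    (Ω : Set PlanarPotential.Plane) (hΩ : Ω = PlanarPotential.curveInterior γ)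
    (h u : PlanarPotential.Plane → ℝ) (hh : ∃ M : ℝ, ∀ y ∈ Ω, |h y| ≤ M)
    (hu : PlanarPotential.IsPoissonSolution Ω h u)
    (x : PlanarPotential.Plane) (hx : x ∈ frontier Ω) :
    IntegrableOn
      (fun y => PlanarPotential.fundamentalSolution (x - y) * Laplacian.laplacian u y) Ω volume ∧
    IntervalIntegrable
      (fun t => (PlanarPotential.fundamentalSolution (x - γ t) * PlanarPotential.normalDeriv γ u t
        - u (γ t) * PlanarPotential.normalDerivKernel γ x t) * ‖deriv γ t‖) volume 0 1 ∧
    ∫ y in Ω, PlanarPotential.fundamentalSolution (x - y) * Laplacian.laplacian u y =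
      (∫ t in (0 : ℝ)..1,
        (PlanarPotential.fundamentalSolution (x - γ t) * PlanarPotential.normalDeriv γ u t
          - u (γ t) * PlanarPotential.normalDerivKernel γ x t) * ‖deriv γ t‖)
      - 1 / 2 * u x := by
  open PlanarPotential in
  subst hΩ
  obtain ⟨t₀, rfl⟩ := hγ.frontier_curveInterior_subset hx
  have hne : (curveInterior γ).Nonempty := by
    rw [← closure_nonempty_iff]
    exact ⟨_, frontier_subset_closure hx⟩
  obtain ⟨σ, δ, hT⟩ := hγ.exists_isInnerTube hne
  have hbd : ∃ M : ℝ, ∀ y ∈ curveInterior γ, |Laplacian.laplacian u y| ≤ M := by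
    obtain ⟨M, hM⟩ := hh
    exact ⟨M, fun y hy => by rw [hu.equation y hy]; exact hM y hy⟩
  have hcl (t : ℝ) : γ t ∈ closure (curveInterior γ) := hT.range_subset_closure ⟨t, rfl⟩
  have hDu : Continuous fun t => fderivWithin ℝ u (closure (curveInterior γ)) (γ t) :=
    (hu.contDiffOn_closure.continuousOn_fderivWithin (hT.uniqueDiffOn_closure hγ)
      le_rfl).comp_continuous hγ.continuous hcl
  have huγ : Continuous fun t => u (γ t) :=
    hu.contDiffOn_closure.continuousOn.comp_continuous hγ.continuous hcl
  -- The integrands of the statement are those of the kernel with regularization parameter `0`.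
  have hΦ (y : Plane) : fundamentalSolution (γ t₀ - y) = regKernel (γ t₀) 0 y :=
    congrFun (fundamentalSolution_sub_eq (γ t₀)) y
  have hbdry : (fun t => (fundamentalSolution (γ t₀ - γ t) * normalDeriv γ u t
      - u (γ t) * normalDerivKernel γ (γ t₀) t) * ‖deriv γ t‖) = fun t =>
      regKernel (γ t₀) 0 (γ t) *
        fderivWithin ℝ u (closure (curveInterior γ)) (γ t) (normalField σ γ t) -
      u (γ t) * fderiv ℝ (regKernel (γ t₀) 0) (γ t) (normalField σ γ t) := by
    funext t
    have hn : ‖deriv γ t‖ ≠ 0 := norm_ne_zero_iff.2 (hγ.regular t)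
    rw [normalDeriv, normalDerivKernel, fundamentalSolution_sub_eq, hΦ, hT.outwardNormal_eq hγ,
      map_smul, map_smul, smul_eq_mul, smul_eq_mul]
    field_simp
  obtain ⟨hB, hBlim⟩ := hγ.tendsto_boundary_integral (σ := σ) t₀
    (hDu.clm_apply (hγ.continuous_normalField (σ := σ))) huγ
    (fun t => by simp only [hγ.periodic t, hγ.periodic_normalField (σ := σ) t])
    (fun t => by simp only [hγ.periodic t])
  obtain ⟨hI, hIlim⟩ := hγ.tendsto_integral_regKernel_mul (x := γ t₀) (fun hx => hx.1 ⟨t₀, rfl⟩)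
    (IsInnerTube.integrableOn_laplacian hγ hu.contDiffOn_interior hbd).aestronglyMeasurable hbd
  have hJlim := hT.tendsto_integral_mul_laplacian_regKernel hγ hu.contDiffOn_closure.continuousOn t₀
  have heq := tendsto_nhds_unique ((hIlim.sub hJlim).congr' (by
    filter_upwards [self_mem_nhdsWithin] with r hr
    exact hT.green_second_identity hγ hu.contDiffOn_interior hu.contDiffOn_closure hbd
      (contDiff_regKernel (γ t₀) hr))) hBlim
  rw [hbdry]
  simp only [hΦ]
  exact ⟨hI, hB, by linarith⟩
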